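/- Let $U=\{u_1,\dots,u_n\}$ and $W=\{w_1,\dots,w_n\}$ be disjoint sets of $n$ agents each. A (strict, possibly incomplete) preference profile $P$ consists of a preference list $\succ^P_x$ for every agent $x\in U\cup W$, that is, a linear order on a subset of the opposite side, whose members are called acceptable to $x$. A matching of $P$ is a set $M$ of pairwise disjoint pairs $\{u,w\}$ with $u\in U$, $w\in W$, where $u$ and $w$ find each other acceptable. A pair $\{u,w\}$ with $u\in U$, $w\in W$ blocks $M$ in $P$ if $u$ and $w$ find each other acceptable, $\{u,w\}\notin M$, and each of $u$, $w$ is either unmatched by $M$ or prefers the other to her partner in $M$. The matching $M$ is stable in $P$ if no pair blocks it. The swap distance of two preference lists is the number of pairs of agents that they order differently if both lists rank the same set of agents, and $\infty$ otherwise; the swap distance $\tau(P,P')$ of two profiles on $U,W$ is the sum, over all $2n$ agents, of the swap distances between the agent's lists in $P$ and in $P'$. For $d\in\mathbb{N}=\{0,1,2,\dots\}$, a set $M$ of pairs is a $d$-robust matching for $P$ if $M$ is a stable matching of $P'$ for every profile $P'$ with $\tau(P,P')\le d$. Theorem. There is an algorithm that, given a preference profile $P$ with $2n$ agents (as tables of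 the $2n$ preference lists) and an integer $d\in\mathbb{N}$, runs in $O(n^4)$ time, with a constant independent of $n$, $P$ and $d$, and either outputs a $d$-robust matching for $P$ or correctly reports that no $d$-robust matching for $P$ exists. Here an algorithm is one fixed program for a random access machine over the natural numbers with addition, truncated subtraction, indirect addressing and tests for zero, and time is the number of elementary operations (unit cost). -/

import Mathlib

/-! ## Preference profiles, stability and robustness -/

namespace StableMarriage

/-- A strict, possibly incomplete preference profile with two disjoint agent sets
`U = {u_0, …, u_{n-1}}` and `W = {w_0, …, w_{n-1}}`, both indexed by `Fin n`.  The preference list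
of an agent (a linear order on the subset of the opposite side that she finds acceptable) is the
duplicate-free list of her acceptable agents, most preferred first.  Acceptability need not be
symmetric. -/
@[ext]
structure Profile (n : ℕ) where
  listU : Fin n → List (Fin n)
  listW : Fin n → List (Fin n)
  nodupU : ∀ u, (listU u).Nodup
  nodupW : ∀ w, (listW w).Nodup

variable {n : ℕ}

/-- The rank of `y` in a preference list: the number of agents preferred to `y`, and the length of
the list if `y` is not acceptable. -/
def rank (l : List (Fin n)) (y : Fin n) : ℕ := l.idxOf y

/-- `u ∈ U` and `w ∈ W` find each other acceptable. -/
def Profile.Acceptable (P : Profile n) (u w : Fin n) : Prop :=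
  w ∈ P.listU u ∧ u ∈ P.listW w

/-- `M`, whose members `(u, w)` stand for the pairs `{u, w}` with `u ∈ U` and `w ∈ W`, is a matching
of `P`: a set of pairwise disjoint pairs of agents that find each other acceptable. -/
def IsMatching (P : Profile n) (M : Finset (Fin n × Fin n)) : Prop :=
  (∀ p ∈ M, ∀ q ∈ M, p ≠ q → p.1 ≠ q.1 ∧ p.2 ≠ q.2) ∧ ∀ p ∈ M, P.Acceptable p.1 p.2

/-- The pair `{u, w}` blocks `M` in `P`: its members find each other acceptable, are not matched
together, and each of them is unmatched or prefers the other one to her partner. -/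
def IsBlocking (P : Profile n) (M : Finset (Fin n × Fin n)) (u w : Fin n) : Prop :=
  P.Acceptable u w ∧ (u, w) ∉ M ∧
    (∀ w', (u, w') ∈ M → rank (P.listU u) w < rank (P.listU u) w') ∧
    (∀ u', (u', w) ∈ M → rank (P.listW w) u < rank (P.listW w) u')

/-- `M` is a stable matching of `P`. -/
def IsStable (P : Profile n) (M : Finset (Fin n × Fin n)) : Prop :=
  IsMatching P M ∧ ∀ u w, ¬ IsBlocking P M u w

open Classical in
/-- The swap (Kendall tau) distance of two preference lists: the number of pairs of agents that they
order differently (each such pair `{x, y}` is counted once, with `x` the one that comes first in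
`l`), and infinity if they rank different sets of agents. -/
noncomputable def swapDist (l l' : List (Fin n)) : ℕ∞ :=
  if ∀ x, x ∈ l ↔ x ∈ l' then
    (((Finset.univ : Finset (Fin n × Fin n)).filter fun p =>
      p.1 ∈ l ∧ p.2 ∈ l ∧ rank l p.1 < rank l p.2 ∧ rank l' p.2 < rank l' p.1).card : ℕ∞)
  else ⊤

/-- The swap distance of two profiles: the sum over all agents of the swap distances of their
preference lists. -/
noncomputable def profileDist (P Q : Profile n) : ℕ∞ :=
  ∑ u, swapDist (P.listU u) (Q.listU u) + ∑ w, swapDist (P.listW w) (Q.listW w)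

/-- `M` is `d`-robust for `P`: it is a stable matching of every profile within swap distance `d`
of `P` (in particular of `P` itself). -/
def IsRobust (P : Profile n) (d : ℕ) (M : Finset (Fin n × Fin n)) : Prop :=
  ∀ Q : Profile n, profileDist P Q ≤ (d : ℕ∞) → IsStable Q M

end StableMarriage

/-! ## Random access machine programs with unit cost

Programs for a random access machine, in structured form.  The memory holds natural numbers: scalar
registers and arrays with indirect addressing, both named by natural numbers; as a program is a
finite piece of text, it uses finitely many of them.  The arithmetic operations are addition and
truncated subtraction (no multiplication, no bit operations), and every single operation, memory
access, assignment and test costs one time unit. -/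

namespace RAM

structure State where
  reg : ℕ → ℕ
  arr : ℕ → ℕ → ℕ

inductive Expr where
  /-- a constant -/
  | const (c : ℕ)
  /-- the content of register `x` -/
  | reg (x : ℕ)
  /-- the content of the cell of array `a` with the given index -/
  | get (a : ℕ) (i : Expr)
  | add (e f : Expr)
  | sub (e f : Expr)

def Expr.eval (s : State) : Expr → ℕ
  | .const c => c
  | .reg x => s.reg x
  | .get a i => s.arr a (i.eval s)
  | .add e f => e.eval s + f.eval s
  | .sub e f => e.eval s - f.eval s

/-- The time to evaluate an expression: one unit for each of its operations. -/
def Expr.cost : Expr → ℕ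
  | .const _ => 1
  | .reg _ => 1
  | .get _ i => i.cost + 1
  | .add e f => e.cost + f.cost + 1
  | .sub e f => e.cost + f.cost + 1

inductive Cmd where
  | skip
  /-- register `x` receives the value of `e` -/
  | assign (x : ℕ) (e : Expr)
  /-- the cell of array `a` with index the value of `i` receives the value of `e` -/
  | put (a : ℕ) (i e : Expr)
  | seq (c₁ c₂ : Cmd)
  /-- if the value of `e` is not zero then `c₁`, else `c₂` -/
  | cond (e : Expr) (c₁ c₂ : Cmd)
  /-- while the value of `e` is not zero, do `c` -/
  | loop (e : Expr) (c : Cmd)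

def State.setReg (s : State) (x v : ℕ) : State :=
  { s with reg := Function.update s.reg x v }

def State.setArr (s : State) (a i v : ℕ) : State :=
  { s with arr := Function.update s.arr a (Function.update (s.arr a) i v) }

/-- `Exec c s t s'`: started in state `s`, the program `c` halts after exactly `t` time units, in
state `s'`. -/
inductive Exec : Cmd → State → ℕ → State → Prop
  | skip (s : State) : Exec .skip s 1 s
  | assign (s : State) (x : ℕ) (e : Expr) :
      Exec (.assign x e) s (e.cost + 1) (s.setReg x (e.eval s))
  | put (s : State) (a : ℕ) (i e : Expr) :
      Exec (.put a i e) s (i.cost + e.cost + 1) (s.setArr a (i.eval s) (e.eval s))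
  | seq {c₁ c₂ : Cmd} {s s₁ s₂ : State} {t₁ t₂ : ℕ}
      (h₁ : Exec c₁ s t₁ s₁) (h₂ : Exec c₂ s₁ t₂ s₂) : Exec (.seq c₁ c₂) s (t₁ + t₂) s₂
  | cond_true {e : Expr} {c₁ c₂ : Cmd} {s s' : State} {t : ℕ}
      (he : e.eval s ≠ 0) (h : Exec c₁ s t s') : Exec (.cond e c₁ c₂) s (e.cost + 1 + t) s'
  | cond_false {e : Expr} {c₁ c₂ : Cmd} {s s' : State} {t : ℕ}
      (he : e.eval s = 0) (h : Exec c₂ s t s') : Exec (.cond e c₁ c₂) s (e.cost + 1 + t) s'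
  | loop_done {e : Expr} {c : Cmd} {s : State}
      (he : e.eval s = 0) : Exec (.loop e c) s (e.cost + 1) s
  | loop_step {e : Expr} {c : Cmd} {s s₁ s₂ : State} {t₁ t₂ : ℕ}
      (he : e.eval s ≠ 0) (h₁ : Exec c s t₁ s₁) (h₂ : Exec (.loop e c) s₁ t₂ s₂) :
      Exec (.loop e c) s (e.cost + 1 + t₁ + t₂) s₂

/-- Programs are deterministic: the running time and the final state are unique. -/
theorem Exec.deterministic {c : Cmd} {s s₁ s₂ : State} {t₁ t₂ : ℕ}
    (h₁ : Exec c s t₁ s₁) (h₂ : Exec c s t₂ s₂) : t₁ = t₂ ∧ s₁ = s₂ := by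
  induction h₁ generalizing t₂ s₂ with
  | skip s => cases h₂; exact ⟨rfl, rfl⟩
  | assign s x e => cases h₂; exact ⟨rfl, rfl⟩
  | put s a i e => cases h₂; exact ⟨rfl, rfl⟩
  | seq _ _ ih₁ ih₂ =>
    cases h₂ with
    | seq k₁ k₂ =>
      obtain ⟨rfl, rfl⟩ := ih₁ k₁
      obtain ⟨rfl, rfl⟩ := ih₂ k₂
      exact ⟨rfl, rfl⟩
  | cond_true he _ ih =>
    cases h₂ with
    | cond_true _ k => obtain ⟨rfl, rfl⟩ := ih k; exact ⟨rfl, rfl⟩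
    | cond_false he' _ => exact absurd he' he
  | cond_false he _ ih =>
    cases h₂ with
    | cond_true he' _ => exact absurd he he'
    | cond_false _ k => obtain ⟨rfl, rfl⟩ := ih k; exact ⟨rfl, rfl⟩
  | loop_done he =>
    cases h₂ with
    | loop_done _ => exact ⟨rfl, rfl⟩
    | loop_step he' _ _ => exact absurd he he'
  | loop_step he _ _ ih₁ ih₂ =>
    cases h₂ with
    | loop_done he' => exact absurd he' he
    | loop_step _ k₁ k₂ =>
      obtain ⟨rfl, rfl⟩ := ih₁ k₁
      obtain ⟨rfl, rfl⟩ := ih₂ k₂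
      exact ⟨rfl, rfl⟩

end RAM

/-! ## Input and output of programs for the problem -/

namespace StableMarriage

variable {n : ℕ}

/-- The lengths of `n` preference lists, as an array. -/
def lengthArray (L : Fin n → List (Fin n)) (i : ℕ) : ℕ :=
  if h : i < n then (L ⟨i, h⟩).length else 0

/-- The entries of `n` preference lists, as an `n × n` table stored row by row: cell `i * n + k`
holds the `k`-th entry (counted from `0`) of the `i`-th list; all other cells hold `0`. -/
def entryArray (L : Fin n → List (Fin n)) (j : ℕ) : ℕ :=
  if h : j / n < n then ((L ⟨j / n, h⟩).map Fin.val).getD (j % n) 0 else 0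

/-- The initial memory on input `(P, d)`: register `0` holds `n`, register `1` holds `d`, arrays `0`
and `1` hold the preference lists of the agents in `U`, arrays `2` and `3` those of the agents in
`W`; everything else is zero. -/
def inputState (P : Profile n) (d : ℕ) : RAM.State where
  reg x := if x = 0 then n else if x = 1 then d else 0
  arr a :=
    if a = 0 then lengthArray P.listU
    else if a = 1 then entryArray P.listU
    else if a = 2 then lengthArray P.listW
    else if a = 3 then entryArray P.listW
    else fun _ => 0

/-- The memory `s` answers "`M`": register `0` holds `1` and cell `u` of array `4` holds `w + 1` if
`u` is matched to `w`, and `0` if `u` is unmatched. -/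
def OutputsMatching (s : RAM.State) (M : Finset (Fin n × Fin n)) : Prop :=
  s.reg 0 = 1 ∧
    (∀ u w : Fin n, (u, w) ∈ M → s.arr 4 u = w + 1) ∧
    (∀ u : Fin n, (∀ w : Fin n, (u, w) ∉ M) → s.arr 4 u = 0)

/-- The memory `s` answers "no such matching exists": register `0` holds `0`. -/
def OutputsNone (s : RAM.State) : Prop := s.reg 0 = 0

end StableMarriage

/-! Robustness is local. To make a pair outside `M` block, `u` has to move `w` past her partner and
`w` has to move `u` past his; each costs exactly the difference of ranks (zero if the other agent is
already preferred or the agent is unmatched). So a matching is `d`-robust iff, for every acceptable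
pair outside of it, these two truncated differences sum to more than `d` (`isRobust_iff`).

This criterion allows a generalised Gale–Shapley procedure. It keeps a lower bound `A u` for the
rank of the partner of `u` and a strict upper bound `T w` for the rank of the partner of `w`, valid
in every robust matching. A pair that the bounds exclude satisfies the inequality above, and
replacing the rank of the partner of `u` by `A u` turns it into a new bound for `w`. A pair not yet
excluded, with `w` at most `d` ranks below `A u`, forces `w` to get `u` or someone better. If the
agent at rank `A u` is excluded as a partner, `A u` increases (`update_relaxT`, `update_relaxA`).

When no pair improves a bound, let each `u` with `A u` below the length of her list take the agent
at that rank. These pairs form a matching in which `w` has a partner of rank `T w - 1`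
(`isMatching_pairsAt`). If every `w` that must be matched is matched, the fixpoint equations are
precisely the robustness inequalities (`isRobust_pairsAt`). Otherwise counting shows that no robust
matching exists (`exists_mem_pairsAt_of_isRobust`).

For the time bound: every scan over the at most `n ^ 2` pairs, except the last, decreases `slack`,
which is quadratic in `n` at the start. Hence there are `O(n ^ 2)` scans of `O(n ^ 2)` steps each.
-/

namespace StableMarriage

variable {n : ℕ}

/-! ## A local characterisation of robustness -/

/-- The rank of the first agent of `l` that satisfies `S`, and the length of `l` if there is none:
for the partners `S` of an agent with preference list `l`, the rank of her partner. -/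
def partnerRank (l : List (Fin n)) (S : Fin n → Prop) [DecidablePred S] : ℕ :=
  l.findIdx fun y => decide (S y)

theorem rank_lt_length {l : List (Fin n)} {y : Fin n} : rank l y < l.length ↔ y ∈ l :=
  List.idxOf_lt_length_iff

theorem rank_inj {l : List (Fin n)} {x y : Fin n} (hx : x ∈ l) (h : rank l x = rank l y) :
    x = y :=
  (List.idxOf_inj hx).1 h

theorem rank_getElem {l : List (Fin n)} (hl : l.Nodup) {k : ℕ} (hk : k < l.length) :
    rank l l[k] = k :=
  hl.idxOf_getElem k hk

theorem getElem_rank {l : List (Fin n)} {y : Fin n} (hy : rank l y < l.length) :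
    l[rank l y] = y :=
  List.getElem_idxOf hy

theorem length_le_of_nodup {l : List (Fin n)} (hl : l.Nodup) : l.length ≤ n := by
  simpa using hl.length_le_card

theorem partnerRank_le_length (l : List (Fin n)) (S : Fin n → Prop) [DecidablePred S] :
    partnerRank l S ≤ l.length :=
  List.findIdx_le_length

theorem partnerRank_eq_rank {l : List (Fin n)} {S : Fin n → Prop} [DecidablePred S] {y : Fin n}
    (hS : ∀ z, S z ↔ z = y) : partnerRank l S = rank l y := by
  unfold partnerRank rank List.idxOf
  congr 1
  funext z
  by_cases h : z = y <;> simp [hS, h]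

theorem partnerRank_of_forall_not {l : List (Fin n)} {S : Fin n → Prop} [DecidablePred S]
    (hS : ∀ z, ¬ S z) : partnerRank l S = l.length := by
  unfold partnerRank
  rw [List.findIdx_eq_length]
  simp [hS]

theorem swapDist_self (l : List (Fin n)) : swapDist l l = 0 := by
  unfold swapDist
  simp only [implies_true, if_true, Nat.cast_eq_zero, Finset.card_eq_zero]
  ext p
  simp only [Finset.mem_filter]
  constructor
  · rintro ⟨-, -, -, h, h'⟩
    omega
  · simp

theorem mem_iff_of_swapDist_ne_top {l l' : List (Fin n)} (h : swapDist l l' ≠ ⊤) (x : Fin n) :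
    x ∈ l ↔ x ∈ l' := by
  unfold swapDist at h
  split_ifs at h with h'
  · exact h' x
  · exact absurd rfl h

/-- Passing an agent that is ahead by some number of ranks takes at least as many swaps. -/
theorem rank_sub_rank_le_swapDist {l l' : List (Fin n)} (hl : l.Nodup) {x y : Fin n} (hx : x ∈ l)
    (h : rank l' x < rank l' y) : ((rank l x - rank l y : ℕ) : ℕ∞) ≤ swapDist l l' := by
  classical
  unfold swapDist
  split_ifs with hmem
  swap
  · exact le_top
  have hxl := rank_lt_length.2 hx
  rw [Nat.cast_le, ← Nat.card_Ico]
  -- Each agent `z` of `l` from `y` up to just before `x` yields its own inversion: if `l'` puts `x`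
  -- before `z`, then `(z, x)` is inverted; otherwise `z` comes no later than `x`, hence before `y`,
  -- and `(y, z)` is inverted.
  let f : ℕ → Fin n × Fin n := fun i =>
    if rank l' x < rank l' (l.getD i x) then (l.getD i x, x) else (y, l.getD i x)
  apply Finset.card_le_card_of_injOn f
  · intro i hi
    simp only [Finset.coe_Ico, Set.mem_Ico] at hi
    have hil : i < l.length := by omega
    have hi' : rank l (l.getD i x) = i := by
      rw [List.getD_eq_getElem _ _ hil]; exact rank_getElem hl hil
    have hm : l.getD i x ∈ l := by
      rw [List.getD_eq_getElem _ _ hil]; exact List.getElem_mem _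
    have hyl : y ∈ l := rank_lt_length.1 (by omega)
    simp only [Finset.coe_filter, Finset.mem_univ, true_and, Set.mem_ofPred_eq, f]
    split_ifs with hc
    · exact ⟨hm, hx, by simp only [hi']; omega, hc⟩
    · refine ⟨hyl, hm, ?_, by simp only; omega⟩
      simp only [hi']
      -- The position of `y` itself always falls under the first alternative, as `l'` puts `x`
      -- before `y`.
      rcases hi.1.lt_or_eq with h1 | h1
      · exact h1
      · exfalso
        have : y = l.getD i x := rank_inj hyl (by rw [hi', h1])
        rw [← this] at hc
        exact hc h
  · intro i hi j hj hij
    simp only [Finset.coe_Ico, Set.mem_Ico] at hi hj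
    have hil : i < l.length := by omega
    have hjl : j < l.length := by omega
    have hi' : rank l (l.getD i x) = i := by
      rw [List.getD_eq_getElem _ _ hil]; exact rank_getElem hl hil
    have hj' : rank l (l.getD j x) = j := by
      rw [List.getD_eq_getElem _ _ hjl]; exact rank_getElem hl hjl
    -- Inversions of the two kinds never coincide: that would make `x` one of the agents strictly
    -- before `x`.
    have key : l.getD i x = l.getD j x := by
      simp only [f] at hij
      split_ifs at hij
      · exact (Prod.mk.inj hij).1
      · have := (Prod.mk.inj hij).2
        rw [← this] at hj'; omega
      · have := (Prod.mk.inj hij).2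
        rw [this] at hi'; omega
      · exact (Prod.mk.inj hij).2
    rw [← hi', ← hj', key]

/-- An agent can be moved up to pass another one by as many swaps as the ranks differ. -/
theorem exists_rank_lt_of_rank_lt {l : List (Fin n)} (hl : l.Nodup) {x y : Fin n} (hx : x ∈ l)
    (h : rank l y < rank l x) :
    ∃ l' : List (Fin n), l'.Nodup ∧ (∀ z, z ∈ l ↔ z ∈ l') ∧ rank l' x < rank l' y ∧
      swapDist l l' ≤ ((rank l x - rank l y : ℕ) : ℕ∞) := by
  classical
  have hy : y ∈ l := rank_lt_length.1 (h.trans (rank_lt_length.2 hx))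
  obtain ⟨p, q, rfl, hyp⟩ := List.eq_append_cons_of_mem hy
  have hxy : x ≠ y := by rintro rfl; omega
  have hxp : x ∉ p := by
    intro hxp
    simp [rank, List.idxOf_append, hxp, hyp] at h
    have := List.idxOf_lt_length_iff.2 hxp
    omega
  have hxq : x ∈ q := by simpa [hxp, hxy] using hx
  obtain ⟨m, r, rfl, hxm⟩ := List.eq_append_cons_of_mem hxq
  -- The new list takes `x` out and reinserts it directly in front of `y`.
  have hperm : (p ++ x :: y :: (m ++ r)).Perm (p ++ y :: (m ++ x :: r)) := by
    refine List.Perm.append_left p ((List.Perm.swap _ _ _).trans (List.Perm.cons _ ?_))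
    exact List.perm_middle.symm
  have hmem : ∀ z, z ∈ p ++ y :: (m ++ x :: r) ↔ z ∈ p ++ x :: y :: (m ++ r) := fun z =>
    hperm.mem_iff.symm
  refine ⟨p ++ x :: y :: (m ++ r), hperm.nodup_iff.2 hl, hmem, ?_, ?_⟩
  · simp [rank, List.idxOf_append, hxp, hyp, hxy]
  · have hd : rank (p ++ y :: (m ++ x :: r)) x - rank (p ++ y :: (m ++ x :: r)) y
        = (y :: m).length := by
      simp [rank, List.idxOf_append, hxp, hyp, hxm, Ne.symm hxy]
    rw [hd]
    unfold swapDist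
    rw [if_pos hmem, Nat.cast_le]
    -- The only inverted pairs consist of `x` and an agent that it jumps over.
    refine le_trans (Finset.card_le_card (t := (y :: m).toFinset ×ˢ {x}) ?_) ?_
    · rintro ⟨a, b⟩ hab
      simp only [Finset.mem_filter, Finset.mem_univ, true_and] at hab
      obtain ⟨ha, hb, h1, h2⟩ := hab
      simp only [Finset.mem_product, List.mem_toFinset, Finset.mem_singleton, List.mem_cons]
      have hpa : ∀ z, z ∈ p → p.idxOf z < p.length := fun z => List.idxOf_lt_length_iff.2
      have hma : ∀ z, z ∈ m → m.idxOf z < m.length := fun z => List.idxOf_lt_length_iff.2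
      have h3 := hpa a
      have h4 := hpa b
      have h5 := hma a
      have h6 := hma b
      simp only [rank, List.idxOf_append, List.idxOf_cons] at h1 h2
      grind
    · simp only [Finset.card_product, Finset.card_singleton, mul_one]
      exact List.toFinset_card_le _

/-- An agent can be moved up to pass the partner by as many swaps as the ranks differ. -/
theorem exists_rank_lt_partner {l : List (Fin n)} (hl : l.Nodup) {x : Fin n} (hx : x ∈ l)
    (S : Fin n → Prop) [DecidablePred S] (hS : ∀ y z, S y → S z → y = z) (hxS : ¬ S x) :
    ∃ l' : List (Fin n), l'.Nodup ∧ (∀ z, z ∈ l ↔ z ∈ l') ∧ (∀ y, S y → rank l' x < rank l' y) ∧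
      swapDist l l' ≤ ((rank l x - partnerRank l S : ℕ) : ℕ∞) := by
  by_cases h : ∃ y, S y
  · obtain ⟨y, hy⟩ := h
    have hSy : ∀ z, S z ↔ z = y := fun z => ⟨fun hz => hS z y hz hy, fun hz => hz ▸ hy⟩
    rw [partnerRank_eq_rank hSy]
    simp only [hSy, forall_eq]
    by_cases hlt : rank l y < rank l x
    · exact exists_rank_lt_of_rank_lt hl hx hlt
    -- Here `x` is already ahead of the partner, so no swap is needed.
    · refine ⟨l, hl, fun _ => Iff.rfl, ?_, by simp [swapDist_self]⟩
      have : rank l x ≠ rank l y := fun h' => hxS (rank_inj hx h' ▸ hy)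
      omega
  · push Not at h
    exact ⟨l, hl, fun _ => Iff.rfl, fun y hy => absurd hy (h y), by simp [swapDist_self]⟩

/-! ### Partner ranks and the robustness criterion -/

/-- The rank of the partner of `u ∈ U` in `M`, or the length of the list if `u` is unmatched. -/
def rankU (P : Profile n) (M : Finset (Fin n × Fin n)) (u : Fin n) : ℕ :=
  partnerRank (P.listU u) fun w => (u, w) ∈ M

/-- The rank of the partner of `w ∈ W` in `M`, or the length of the list if `w` is unmatched. -/
def rankW (P : Profile n) (M : Finset (Fin n × Fin n)) (w : Fin n) : ℕ :=
  partnerRank (P.listW w) fun u => (u, w) ∈ M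

theorem IsMatching.right_unique {P : Profile n} {M : Finset (Fin n × Fin n)} (h : IsMatching P M)
    {u w w' : Fin n} (h₁ : (u, w) ∈ M) (h₂ : (u, w') ∈ M) : w = w' := by
  by_contra hne
  exact (h.1 _ h₁ _ h₂ fun h' => hne (Prod.mk.inj h').2).1 rfl

theorem IsMatching.left_unique {P : Profile n} {M : Finset (Fin n × Fin n)} (h : IsMatching P M)
    {u u' w : Fin n} (h₁ : (u, w) ∈ M) (h₂ : (u', w) ∈ M) : u = u' := by
  by_contra hne
  exact (h.1 _ h₁ _ h₂ fun h' => hne (Prod.mk.inj h').1).2 rfl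

theorem IsMatching.rankU_eq {P : Profile n} {M : Finset (Fin n × Fin n)} (h : IsMatching P M)
    {u w : Fin n} (hm : (u, w) ∈ M) : rankU P M u = rank (P.listU u) w :=
  partnerRank_eq_rank fun _ => ⟨fun hz => h.right_unique hz hm, fun hz => hz ▸ hm⟩

theorem IsMatching.rankW_eq {P : Profile n} {M : Finset (Fin n × Fin n)} (h : IsMatching P M)
    {u w : Fin n} (hm : (u, w) ∈ M) : rankW P M w = rank (P.listW w) u :=
  partnerRank_eq_rank fun _ => ⟨fun hz => h.left_unique hz hm, fun hz => hz ▸ hm⟩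

theorem exists_mem_of_rankU_lt {P : Profile n} {M : Finset (Fin n × Fin n)} {u : Fin n}
    (h : rankU P M u < (P.listU u).length) : ∃ w, (u, w) ∈ M := by
  by_contra! hne
  exact h.ne (partnerRank_of_forall_not hne)

theorem exists_mem_of_rankW_lt {P : Profile n} {M : Finset (Fin n × Fin n)} {w : Fin n}
    (h : rankW P M w < (P.listW w).length) : ∃ u, (u, w) ∈ M := by
  by_contra! hne
  exact h.ne (partnerRank_of_forall_not hne)

theorem swapDist_le_profileDist (P Q : Profile n) (u w : Fin n) :
    swapDist (P.listU u) (Q.listU u) + swapDist (P.listW w) (Q.listW w) ≤ profileDist P Q :=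
  add_le_add
    (Finset.single_le_sum (f := fun u => swapDist (P.listU u) (Q.listU u))
      (fun _ _ => zero_le) (Finset.mem_univ u))
    (Finset.single_le_sum (f := fun w => swapDist (P.listW w) (Q.listW w))
      (fun _ _ => zero_le) (Finset.mem_univ w))

theorem acceptable_iff_of_profileDist {P Q : Profile n} {d : ℕ} (h : profileDist P Q ≤ d)
    (u w : Fin n) : P.Acceptable u w ↔ Q.Acceptable u w := by
  have h' := ((swapDist_le_profileDist P Q u w).trans h).trans_lt (ENat.natCast_lt_top d)
  have hu : swapDist (P.listU u) (Q.listU u) ≠ ⊤ := (le_self_add.trans_lt h').ne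
  have hw : swapDist (P.listW w) (Q.listW w) ≠ ⊤ := (le_add_self.trans_lt h').ne
  simp only [Profile.Acceptable, mem_iff_of_swapDist_ne_top hu, mem_iff_of_swapDist_ne_top hw]

/-- A matching is `d`-robust if and only if every acceptable pair outside of it takes more than `d`
swaps to become blocking. -/
theorem isRobust_iff {P : Profile n} {d : ℕ} {M : Finset (Fin n × Fin n)} :
    IsRobust P d M ↔ IsMatching P M ∧ ∀ u w, P.Acceptable u w → (u, w) ∉ M →
      d < (rank (P.listU u) w - rankU P M u) + (rank (P.listW w) u - rankW P M w) := by
  classical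
  constructor
  · intro h
    have hM : IsMatching P M := (h P (by simp [profileDist, swapDist_self])).1
    refine ⟨hM, fun u w hac hnm => ?_⟩
    by_contra! hle
    obtain ⟨l, hl, hlm, hlt, hld⟩ := exists_rank_lt_partner (P.nodupU u) hac.1
      (fun w => (u, w) ∈ M) (fun _ _ => hM.right_unique) hnm
    obtain ⟨l', hl', hlm', hlt', hld'⟩ := exists_rank_lt_partner (P.nodupW w) hac.2
      (fun u => (u, w) ∈ M) (fun _ _ => hM.left_unique) hnm
    -- Only the lists of `u` and `w` change, so the distance is the sum of the two individual ones.
    let Q : Profile n :=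
      { listU := Function.update P.listU u l
        listW := Function.update P.listW w l'
        nodupU := fun v => by
          by_cases hv : v = u
          · subst hv; simpa using hl
          · simpa [hv] using P.nodupU v
        nodupW := fun v => by
          by_cases hv : v = w
          · subst hv; simpa using hl'
          · simpa [hv] using P.nodupW v }
    have hu : Q.listU u = l := Function.update_self ..
    have hw : Q.listW w = l' := Function.update_self ..
    have hQ : profileDist P Q ≤ d := by
      unfold profileDist
      rw [Finset.sum_eq_single u, Finset.sum_eq_single w, hu, hw]
      · refine (add_le_add hld hld').trans ?_
        exact_mod_cast hle
      · intro v _ hv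
        simp [Q, Function.update_of_ne hv, swapDist_self]
      · simp
      · intro v _ hv
        simp [Q, Function.update_of_ne hv, swapDist_self]
      · simp
    refine (h Q hQ).2 u w ⟨(acceptable_iff_of_profileDist hQ u w).1 hac, hnm, ?_, ?_⟩
    · rw [hu]; exact hlt
    · rw [hw]; exact hlt'
  · rintro ⟨hM, h⟩ Q hQ
    have hacc := acceptable_iff_of_profileDist hQ
    refine ⟨⟨hM.1, fun p hp => (hacc _ _).1 (hM.2 p hp)⟩, ?_⟩
    rintro u w ⟨hac, hnm, hbu, hbw⟩
    have hac' := (hacc u w).2 hac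
    refine (h u w hac' hnm).not_ge ?_
    have h1 : ((rank (P.listU u) w - rankU P M u : ℕ) : ℕ∞) ≤
        swapDist (P.listU u) (Q.listU u) := by
      by_cases hm : ∃ w', (u, w') ∈ M
      · obtain ⟨w', hw'⟩ := hm
        rw [hM.rankU_eq hw']
        exact rank_sub_rank_le_swapDist (P.nodupU u) hac'.1 (hbu w' hw')
      · push Not at hm
        have : rank (P.listU u) w < (P.listU u).length := rank_lt_length.2 hac'.1
        -- An unmatched agent accepts any acceptable partner without a swap; the value `length` for
        -- her partner rank makes the truncated difference vanish.
        rw [rankU, partnerRank_of_forall_not hm, Nat.sub_eq_zero_of_le this.le]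
        exact zero_le
    have h2 : ((rank (P.listW w) u - rankW P M w : ℕ) : ℕ∞) ≤
        swapDist (P.listW w) (Q.listW w) := by
      by_cases hm : ∃ u', (u', w) ∈ M
      · obtain ⟨u', hu'⟩ := hm
        rw [hM.rankW_eq hu']
        exact rank_sub_rank_le_swapDist (P.nodupW w) hac'.2 (hbw u' hu')
      · push Not at hm
        have : rank (P.listW w) u < (P.listW w).length := rank_lt_length.2 hac'.2
        rw [rankW, partnerRank_of_forall_not hm, Nat.sub_eq_zero_of_le this.le]
        exact zero_le
    exact_mod_cast ((add_le_add h1 h2).trans (swapDist_le_profileDist P Q u w)).trans hQ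

/-! ## Bounds for robust matchings and their relaxation -/

/-- In every `d`-robust matching, each `u ∈ U` has a partner of rank at least `A u` or none, and
each `w ∈ W` has a partner of rank less than `T w`, or is unmatched and `T w` exceeds the length of
her list. -/
structure IsBound (P : Profile n) (d : ℕ) (A T : Fin n → ℕ) : Prop where
  le_length : ∀ u, A u ≤ (P.listU u).length
  le_length_succ : ∀ w, T w ≤ (P.listW w).length + 1
  le_rankU : ∀ M, IsRobust P d M → ∀ u, A u ≤ rankU P M u
  rankW_lt : ∀ M, IsRobust P d M → ∀ w, rankW P M w < T w

/-- The bound for `w` that follows from the pair `(u, w)`. -/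
def relaxT (P : Profile n) (d : ℕ) (A T : Fin n → ℕ) (u w : Fin n) : ℕ :=
  if u ∈ P.listW w then
    if rank (P.listU u) w < A u ∨ T w ≤ rank (P.listW w) u then
      min (T w) (rank (P.listW w) u + (rank (P.listU u) w - A u) - d)
    else if rank (P.listU u) w - A u ≤ d then min (T w) (rank (P.listW w) u + 1)
    else T w
  else T w

/-- The bound for `u` that follows from the pair `(u, w)`. -/
def relaxA (P : Profile n) (A T : Fin n → ℕ) (u w : Fin n) : ℕ :=
  if rank (P.listU u) w = A u ∧ (u ∈ P.listW w → T w ≤ rank (P.listW w) u) then A u + 1 else A u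

theorem relaxT_le (P : Profile n) (d : ℕ) (A T : Fin n → ℕ) (u w : Fin n) :
    relaxT P d A T u w ≤ T w := by
  unfold relaxT
  split_ifs <;> simp

theorem le_relaxA (P : Profile n) (A T : Fin n → ℕ) (u w : Fin n) :
    A u ≤ relaxA P A T u w := by
  unfold relaxA
  split_ifs <;> simp

/-- No bound improves by relaxation with the pair `(u, w)`. -/
def IsRelaxed (P : Profile n) (d : ℕ) (A T : Fin n → ℕ) (u w : Fin n) : Prop :=
  relaxT P d A T u w = T w ∧ relaxA P A T u w = A u

theorem isBound_initial (P : Profile n) (d : ℕ) :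
    IsBound P d (fun _ => 0) (fun w => (P.listW w).length + 1) :=
  ⟨fun _ => Nat.zero_le _, fun _ => le_rfl, fun _ _ _ => Nat.zero_le _,
    fun _ _ _ => Nat.lt_succ_of_le (partnerRank_le_length _ _)⟩

namespace IsBound

variable {P : Profile n} {d : ℕ} {A T : Fin n → ℕ}

/-- Soundness of the rule for `W`: the robustness inequality is monotone in the rank of the partner
of `u`, so the lower bound `A u` may be substituted for it. -/
theorem update_relaxT (h : IsBound P d A T) (u : Fin n) {w : Fin n} (hw : w ∈ P.listU u) :
    IsBound P d A (Function.update T w (relaxT P d A T u w)) := by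
  refine ⟨h.le_length, fun v => ?_, h.le_rankU, fun M hM v => ?_⟩
  · by_cases hv : v = w
    · subst hv
      simpa using (relaxT_le P d A T u v).trans (h.le_length_succ v)
    · simpa [hv] using h.le_length_succ v
  · by_cases hv : v = w
    swap
    · simpa [hv] using h.rankW_lt M hM v
    subst hv
    rw [Function.update_self]
    have hb := h.rankW_lt M hM v
    have ha := h.le_rankU M hM u
    obtain ⟨hM', hd⟩ := isRobust_iff.1 hM
    unfold relaxT
    split_ifs with hac h1 h2
    -- The bounds exclude the pair, so its inequality holds. In both cases of `h1` it can be solved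
    -- for the partner rank of `v`: either `u` contributes nothing, or the contribution of `v` is
    -- not truncated.
    · by_cases hm : (u, v) ∈ M
      · rw [hM'.rankU_eq hm] at ha
        rw [hM'.rankW_eq hm] at hb
        omega
      · have := hd u v ⟨hw, hac⟩ hm
        omega
    -- Either `v` is matched to `u`, or the contribution of `u` is at most `d` and `v` has to prefer
    -- her partner to `u`.
    · by_cases hm : (u, v) ∈ M
      · rw [hM'.rankW_eq hm] at hb ⊢
        omega
      · have := hd u v ⟨hw, hac⟩ hm
        omega
    · exact hb
    · exact hb

theorem update_relaxA (h : IsBound P d A T) {u w : Fin n} (hw : w ∈ P.listU u) :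
    IsBound P d (Function.update A u (relaxA P A T u w)) T := by
  have hlen := rank_lt_length.2 hw
  refine ⟨fun v => ?_, h.le_length_succ, fun M hM v => ?_, h.rankW_lt⟩
  · by_cases hv : v = u
    · subst hv
      have := h.le_length v
      rw [Function.update_self]
      unfold relaxA
      split_ifs <;> omega
    · simpa [hv] using h.le_length v
  · by_cases hv : v = u
    swap
    · simpa [hv] using h.le_rankU M hM v
    subst hv
    rw [Function.update_self]
    have ha := h.le_rankU M hM v
    unfold relaxA
    split_ifs with hc
    -- If the raised bound failed, the partner of `u` would be `w` itself, against the bound `T w`.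
    · by_contra hlt
      have heq : rankU P M v = rank (P.listU v) w := by omega
      obtain ⟨w', hm⟩ := exists_mem_of_rankU_lt (heq.trans_lt hlen)
      have hM' := (isRobust_iff.1 hM).1
      obtain rfl : w = w' := rank_inj hw (by rw [← heq, hM'.rankU_eq hm])
      have h1 := h.rankW_lt M hM w
      rw [hM'.rankW_eq hm] at h1
      have := hc.2 (hM'.2 _ hm).2
      omega
    · exact ha

end IsBound

/-! ### Fixpoints of the relaxation -/

/-- The pairs of each `u ∈ U` with the agent of rank `A u` in her list. -/
def pairsAt (P : Profile n) (A : Fin n → ℕ) : Finset (Fin n × Fin n) :=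
  Finset.univ.filter fun p => p.2 ∈ P.listU p.1 ∧ rank (P.listU p.1) p.2 = A p.1

theorem mem_pairsAt {P : Profile n} {A : Fin n → ℕ} {u w : Fin n} :
    (u, w) ∈ pairsAt P A ↔ w ∈ P.listU u ∧ rank (P.listU u) w = A u := by
  simp [pairsAt]

theorem exists_mem_pairsAt {P : Profile n} {A : Fin n → ℕ} {u : Fin n}
    (h : A u < (P.listU u).length) : ∃ w, (u, w) ∈ pairsAt P A :=
  ⟨(P.listU u)[A u], mem_pairsAt.2 ⟨List.getElem_mem _, rank_getElem (P.nodupU u) h⟩⟩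

section Relaxed

variable {P : Profile n} {d : ℕ} {A T : Fin n → ℕ}

/-- As `A u` does not increase, the pair is acceptable and not excluded by `T w`; as its distance
from `A u` is `0 ≤ d`, the second rule of `relaxT` presses `T w` down to just above the rank of `u`.
-/
theorem IsRelaxed.of_mem_pairsAt {u w : Fin n} (h : IsRelaxed P d A T u w)
    (hm : (u, w) ∈ pairsAt P A) : u ∈ P.listW w ∧ T w = rank (P.listW w) u + 1 := by
  obtain ⟨-, hk⟩ := mem_pairsAt.1 hm
  obtain ⟨h1, h2⟩ := h
  unfold relaxA at h2
  unfold relaxT at h1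
  split_ifs at h2 with hc
  · omega
  have hac : u ∈ P.listW w := by
    by_contra hac
    exact hc ⟨hk, fun h => absurd h hac⟩
  have hlt : ¬ T w ≤ rank (P.listW w) u := fun hle => hc ⟨hk, fun _ => hle⟩
  refine ⟨hac, ?_⟩
  rw [if_pos hac, if_neg (by omega), if_pos (by omega)] at h1
  omega

/-- Two agents paired with the same `w` would both have rank `T w - 1` in her list. -/
theorem isMatching_pairsAt (h : ∀ u, ∀ w ∈ P.listU u, IsRelaxed P d A T u w) :
    IsMatching P (pairsAt P A) := by
  have key : ∀ {u w}, (u, w) ∈ pairsAt P A →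
      u ∈ P.listW w ∧ T w = rank (P.listW w) u + 1 := fun {u w} hm =>
    (h u w (mem_pairsAt.1 hm).1).of_mem_pairsAt hm
  refine ⟨?_, fun p hp => ⟨(mem_pairsAt.1 hp).1, (key hp).1⟩⟩
  rintro ⟨u, w⟩ hp ⟨u', w'⟩ hq hne
  refine ⟨?_, ?_⟩
  · rintro rfl
    obtain ⟨hw, hr⟩ := mem_pairsAt.1 hp
    obtain ⟨-, hr'⟩ := mem_pairsAt.1 hq
    exact hne (by rw [rank_inj hw (hr.trans hr'.symm)])
  · rintro rfl
    obtain ⟨hu, hr⟩ := key hp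
    obtain ⟨-, hr'⟩ := key hq
    exact hne (by rw [rank_inj hu (Nat.succ_injective (hr.symm.trans hr'))])

/-- Under `hw` both bounds are attained, so the fixpoint condition of `relaxT` at a pair reads as
the robustness inequality of that pair. -/
theorem IsBound.isRobust_pairsAt (hb : IsBound P d A T)
    (h : ∀ u, ∀ w ∈ P.listU u, IsRelaxed P d A T u w)
    (hw : ∀ w, T w ≤ (P.listW w).length → ∃ u, (u, w) ∈ pairsAt P A) :
    IsRobust P d (pairsAt P A) := by
  have hM := isMatching_pairsAt h
  refine isRobust_iff.2 ⟨hM, fun u w hac hnm => ?_⟩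
  have hk : rank (P.listU u) w ≠ A u := fun hk => hnm (mem_pairsAt.2 ⟨hac.1, hk⟩)
  have ha : rankU P (pairsAt P A) u = A u := by
    by_cases hlt : A u < (P.listU u).length
    · obtain ⟨w', hw'⟩ := exists_mem_pairsAt hlt
      rw [hM.rankU_eq hw', (mem_pairsAt.1 hw').2]
    · have hle := hb.le_length u
      rw [rankU, partnerRank_of_forall_not]
      · omega
      · intro w' hw'
        obtain ⟨h1, h2⟩ := mem_pairsAt.1 hw'
        have := rank_lt_length.2 h1
        omega
  have hbT : T w = rankW P (pairsAt P A) w + 1 := by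
    by_cases hle : T w ≤ (P.listW w).length
    · obtain ⟨u', hu'⟩ := hw w hle
      rw [hM.rankW_eq hu']
      exact ((h u' w (mem_pairsAt.1 hu').1).of_mem_pairsAt hu').2
    -- Now `T w` is the length plus one, whereas a partner would force it to be at most the length;
    -- so `w` is unmatched.
    · have hle' := hb.le_length_succ w
      rw [rankW, partnerRank_of_forall_not]
      · omega
      · intro u' hu'
        obtain ⟨h1, h2⟩ := (h u' w (mem_pairsAt.1 hu').1).of_mem_pairsAt hu'
        have := rank_lt_length.2 h1
        omega
  rw [ha]
  obtain ⟨h1, -⟩ := h u w hac.1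
  have hr := rank_lt_length.2 hac.2
  unfold relaxT at h1
  rw [if_pos hac.2] at h1
  split_ifs at h1 with h2 h3
  · omega
  -- Here `T w` is one more than the rank of `u`, so the partner of `w` is `u`, although the pair
  -- lies outside the matching.
  · exfalso
    obtain ⟨u', hu'⟩ := hw w (by omega)
    obtain ⟨h4, h5⟩ := (h u' w (mem_pairsAt.1 hu').1).of_mem_pairsAt hu'
    obtain rfl : u' = u := rank_inj h4 (by omega)
    exact hnm hu'
  · omega

/-- A counting argument. A robust matching injects the agents `SW` that must be matched into the
agents `SU` whose bound is within their list, and `pairsAt P A` injects `SU` into `SW`. So the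
second injection is onto. -/
theorem IsBound.exists_mem_pairsAt_of_isRobust (hb : IsBound P d A T)
    (h : ∀ u, ∀ w ∈ P.listU u, IsRelaxed P d A T u w) {M : Finset (Fin n × Fin n)}
    (hMr : IsRobust P d M) {w : Fin n} (hw : T w ≤ (P.listW w).length) :
    ∃ u, (u, w) ∈ pairsAt P A := by
  classical
  have hM := (isRobust_iff.1 hMr).1
  have hN := isMatching_pairsAt h
  let SU : Finset (Fin n) := Finset.univ.filter fun u => A u < (P.listU u).length
  let SW : Finset (Fin n) := Finset.univ.filter fun w => T w ≤ (P.listW w).length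
  have h1 : ∀ w ∈ SW, ∃ u ∈ SU, (u, w) ∈ M := by
    intro w hw
    have hw' : T w ≤ (P.listW w).length := by simpa [SW] using hw
    obtain ⟨u, hu⟩ := exists_mem_of_rankW_lt ((hb.rankW_lt M hMr w).trans_le hw')
    refine ⟨u, ?_, hu⟩
    have h2 := hb.le_rankU M hMr u
    rw [hM.rankU_eq hu] at h2
    have h3 : rank (P.listU u) w < _ := rank_lt_length.2 (hM.2 _ hu).1
    simpa [SU] using h2.trans_lt h3
  have h2 : ∀ u ∈ SU, ∃ w ∈ SW, (u, w) ∈ pairsAt P A := by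
    intro u hu
    have hu' : A u < (P.listU u).length := by simpa [SU] using hu
    obtain ⟨w, hw⟩ := exists_mem_pairsAt hu'
    refine ⟨w, ?_, hw⟩
    obtain ⟨h3, h4⟩ := (h u w (mem_pairsAt.1 hw).1).of_mem_pairsAt hw
    have := rank_lt_length.2 h3
    simp only [SW, Finset.mem_filter, Finset.mem_univ, true_and]
    omega
  choose! f hfSU hf using h1
  choose! g hgSW hg using h2
  have hcard : SW.card ≤ SU.card := Finset.card_le_card_of_injOn f hfSU
    fun w hw w' hw' heq => hM.right_unique (hf w hw) (heq ▸ hf w' hw')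
  have hsurj := Finset.surj_on_of_inj_on_of_card_le (s := SU) (t := SW) (fun u _ => g u)
    (fun u hu => hgSW u hu)
    (fun u u' hu hu' heq => hN.left_unique (hg u hu) (heq ▸ hg u' hu')) hcard
  obtain ⟨u, hu, rfl⟩ := hsurj w (by simpa [SW] using hw)
  exact ⟨u, hg u hu⟩

end Relaxed

end StableMarriage

namespace RAM

/-! ## Total correctness of programs with time bounds -/

/-- Started in state `s`, the program `c` halts within time `T` in a state that satisfies `Q`. -/
def Runs (c : Cmd) (s : State) (T : ℕ) (Q : State → Prop) : Prop :=
  ∃ t s', Exec c s t s' ∧ t ≤ T ∧ Q s'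

theorem Runs.mono {c : Cmd} {s : State} {T T' : ℕ} {Q Q' : State → Prop} (h : Runs c s T Q)
    (hT : T ≤ T') (hQ : ∀ s', Q s' → Q' s') : Runs c s T' Q' := by
  obtain ⟨t, s', he, ht, hq⟩ := h
  exact ⟨t, s', he, ht.trans hT, hQ s' hq⟩

theorem Runs.seq {c₁ c₂ : Cmd} {s : State} {T₁ T₂ : ℕ} {Q₁ Q : State → Prop}
    (h₁ : Runs c₁ s T₁ Q₁) (h₂ : ∀ s₁, Q₁ s₁ → Runs c₂ s₁ T₂ Q) :
    Runs (.seq c₁ c₂) s (T₁ + T₂) Q := by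
  obtain ⟨t₁, s₁, he₁, ht₁, hq₁⟩ := h₁
  obtain ⟨t₂, s₂, he₂, ht₂, hq₂⟩ := h₂ s₁ hq₁
  exact ⟨_, s₂, he₁.seq he₂, Nat.add_le_add ht₁ ht₂, hq₂⟩

/-- A loop whose body takes time at most `K` and decreases the measure `μ` in every round. -/
theorem Runs.loop {e : Expr} {c : Cmd} {K : ℕ} (I : State → Prop) (μ : State → ℕ)
    (hbody : ∀ s, I s → e.eval s ≠ 0 → Runs c s K fun s' => I s' ∧ μ s' < μ s)
    (s : State) (hs : I s) :
    Runs (.loop e c) s ((μ s + 1) * (e.cost + 1 + K)) fun s' => I s' ∧ e.eval s' = 0 := by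
  induction hm : μ s using Nat.strong_induction_on generalizing s with
  | _ m ih =>
    by_cases he : e.eval s = 0
    · exact ⟨_, s, .loop_done he, by nlinarith, hs, he⟩
    · obtain ⟨t₁, s₁, h₁, ht₁, hi, hlt⟩ := hbody s hs he
      obtain ⟨t₂, s₂, h₂, ht₂, hq⟩ := ih (μ s₁) (hm ▸ hlt) s₁ hi rfl
      refine ⟨_, s₂, .loop_step he h₁ h₂, ?_, hq⟩
      have : (μ s₁ + 1) * (e.cost + 1 + K) ≤ m * (e.cost + 1 + K) :=
        Nat.mul_le_mul_right _ (by omega)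
      linarith [add_mul m 1 (e.cost + 1 + K)]

/-- A loop that counts from `0` to `N`, with the invariant `I k` after `k` rounds. -/
theorem Runs.count {e : Expr} {c : Cmd} {K N : ℕ} (I : ℕ → State → Prop)
    (hcond : ∀ k s, k ≤ N → I k s → (e.eval s = 0 ↔ k = N))
    (hbody : ∀ k s, k < N → I k s → Runs c s K (I (k + 1)))
    (s : State) (hs : I 0 s) : Runs (.loop e c) s ((N + 1) * (e.cost + 1 + K)) (I N) := by
  suffices h : ∀ m k s, k + m = N → I k s →
      Runs (.loop e c) s ((m + 1) * (e.cost + 1 + K)) (I N) from h N 0 s (Nat.zero_add N) hs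
  intro m
  induction m with
  | zero =>
    intro k s hk hs
    obtain rfl : k = N := hk
    exact ⟨_, s, .loop_done ((hcond k s le_rfl hs).2 rfl), by omega, hs⟩
  | succ m ih =>
    intro k s hk hs
    obtain ⟨t₁, s₁, h₁, ht₁, hi⟩ := hbody k s (by omega) hs
    obtain ⟨t₂, s₂, h₂, ht₂, hq⟩ := ih (k + 1) s₁ (by omega) hi
    have hne : e.eval s ≠ 0 := fun h => by
      have := (hcond k s (by omega) hs).1 h
      omega
    refine ⟨_, s₂, .loop_step hne h₁ h₂, ?_, hq⟩
    linarith [add_mul (m + 1) 1 (e.cost + 1 + K)]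

/-! ### Loop-free programs, evaluated by simplification -/

/-- The final state of a program without loops. -/
def Cmd.run : Cmd → State → State
  | .skip, s => s
  | .assign x e, s => s.setReg x (e.eval s)
  | .put a i e, s => s.setArr a (i.eval s) (e.eval s)
  | .seq c₁ c₂, s => c₂.run (c₁.run s)
  | .cond e c₁ c₂, s => if e.eval s ≠ 0 then c₁.run s else c₂.run s
  | .loop _ _, s => s

/-- A bound for the time of a program without loops. -/
def Cmd.time : Cmd → ℕ
  | .skip => 1
  | .assign _ e => e.cost + 1
  | .put _ i e => i.cost + e.cost + 1
  | .seq c₁ c₂ => c₁.time + c₂.time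
  | .cond e c₁ c₂ => e.cost + 1 + (c₁.time + c₂.time)
  | .loop _ _ => 0

def Cmd.LoopFree : Cmd → Prop
  | .seq c₁ c₂ => c₁.LoopFree ∧ c₂.LoopFree
  | .cond _ c₁ c₂ => c₁.LoopFree ∧ c₂.LoopFree
  | .loop _ _ => False
  | _ => True

theorem Cmd.LoopFree.exec {c : Cmd} (hc : c.LoopFree) (s : State) :
    ∃ t, Exec c s t (c.run s) ∧ t ≤ c.time := by
  induction c generalizing s with
  | skip => exact ⟨_, .skip s, le_rfl⟩
  | assign x e => exact ⟨_, .assign s x e, le_rfl⟩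
  | put a i e => exact ⟨_, .put s a i e, le_rfl⟩
  | seq c₁ c₂ ih₁ ih₂ =>
    obtain ⟨t₁, h₁, ht₁⟩ := ih₁ hc.1 s
    obtain ⟨t₂, h₂, ht₂⟩ := ih₂ hc.2 (c₁.run s)
    exact ⟨_, h₁.seq h₂, Nat.add_le_add ht₁ ht₂⟩
  | cond e c₁ c₂ ih₁ ih₂ =>
    by_cases he : e.eval s = 0
    · obtain ⟨t, h, ht⟩ := ih₂ hc.2 s
      have hrun : (Cmd.cond e c₁ c₂).run s = c₂.run s := by simp [Cmd.run, he]
      rw [hrun]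
      exact ⟨_, .cond_false he h, by simp only [Cmd.time]; omega⟩
    · obtain ⟨t, h, ht⟩ := ih₁ hc.1 s
      have hrun : (Cmd.cond e c₁ c₂).run s = c₁.run s := by simp [Cmd.run, he]
      rw [hrun]
      exact ⟨_, .cond_true he h, by simp only [Cmd.time]; omega⟩
  | loop _ _ _ => exact hc.elim

theorem Runs.of_loopFree {c : Cmd} {s : State} {Q : State → Prop} (hc : c.LoopFree)
    (hq : Q (c.run s)) : Runs c s c.time Q := by
  obtain ⟨t, h, ht⟩ := hc.exec s
  exact ⟨t, _, h, ht, hq⟩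

end RAM

namespace StableMarriage

open RAM

variable {n : ℕ}

/-! ## The program

Besides the input, the memory has the following cells: array `4` is the output, cell `i` of array
`5` holds `i * n`, cell `w * n + u` of array `6` holds one more than the rank of `u` in the list of
`w` (and `0` if `u` is not in it), arrays `7` and `8` hold the bounds for the agents in `U` and `W`,
and array `9` marks the matched agents in `W`. -/

/-- Increment a register. -/
def incr (x : ℕ) : Cmd := .assign x (.add (.reg x) (.const 1))

/-- Enter one list entry of the agent in register `2` into the table of ranks. -/
def setRank : Cmd :=
  .seq (.put 6 (.add (.reg 3) (.get 3 (.add (.reg 3) (.reg 4)))) (.add (.reg 4) (.const 1)))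
    (incr 4)

/-- Prepare the memory for the agent in register `2`, before her table of ranks. -/
def setupHead : Cmd :=
  .seq (.put 5 (.reg 2) (.reg 3))
    (.seq (.put 8 (.reg 2) (.add (.get 2 (.reg 2)) (.const 1))) (.assign 4 (.const 0)))

/-- Go on to the next row of the tables. -/
def nextRow : Cmd := .seq (.assign 3 (.add (.reg 3) (.reg 0))) (incr 2)

def setup : Cmd :=
  .loop (.sub (.reg 0) (.reg 2))
    (.seq setupHead (.seq (.loop (.sub (.get 2 (.reg 2)) (.reg 4)) setRank) nextRow))

/-- Load the data of the current pair. -/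
def fetchPair : Cmd :=
  .seq (.assign 6 (.get 1 (.add (.reg 3) (.reg 4))))
  (.seq (.assign 7 (.get 6 (.add (.get 5 (.reg 6)) (.reg 2))))
  (.seq (.assign 8 (.get 8 (.reg 6))) (.assign 9 (.get 7 (.reg 2)))))

/-- Compute the new bound for the member in `W` of the current pair. -/
def newBound : Cmd :=
  .cond (.reg 7)
    (.cond (.add (.sub (.reg 9) (.reg 4)) (.sub (.reg 7) (.reg 8)))
      (.assign 10 (.sub (.sub (.add (.reg 7) (.sub (.reg 4) (.reg 9))) (.const 1)) (.reg 1)))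
      (.cond (.sub (.sub (.reg 4) (.reg 9)) (.reg 1)) (.assign 10 (.reg 8)) (.assign 10 (.reg 7))))
    (.assign 10 (.reg 8))

def loadPair : Cmd := .seq fetchPair newBound

/-- Store the new bound for the member in `W` of the current pair. -/
def storeT : Cmd :=
  .cond (.sub (.reg 8) (.reg 10))
    (.seq (.put 8 (.reg 6) (.reg 10)) (.seq (.assign 8 (.reg 10)) (.assign 5 (.const 1)))) .skip

/-- Compute and store the new bound for the member in `U` of the current pair. -/
def storeA : Cmd :=
  .seq (.cond (.reg 7) (.assign 11 (.sub (.add (.reg 8) (.const 1)) (.reg 7)))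
    (.assign 11 (.const 0)))
  (.seq (.cond (.add (.add (.sub (.reg 4) (.reg 9)) (.sub (.reg 9) (.reg 4))) (.reg 11)) .skip
      (.seq (.put 7 (.reg 2) (.add (.reg 9) (.const 1))) (.assign 5 (.const 1))))
    (incr 4))

def relaxPair : Cmd := .seq loadPair (.seq storeT storeA)

/-- Relax the bounds with all pairs. -/
def scan : Cmd :=
  .loop (.sub (.reg 0) (.reg 2))
    (.seq (.assign 4 (.const 0))
      (.seq (.loop (.sub (.get 0 (.reg 2)) (.reg 4)) relaxPair) nextRow))

def scanHead : Cmd :=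
  .seq (.assign 5 (.const 0)) (.seq (.assign 2 (.const 0)) (.assign 3 (.const 0)))

/-- Scan until no bound changes. -/
def relaxAll : Cmd := .seq (.assign 5 (.const 1)) (.loop (.reg 5) (.seq scanHead scan))

def outputPair : Cmd :=
  .seq (.cond (.sub (.get 0 (.reg 2)) (.get 7 (.reg 2)))
      (.seq (.assign 6 (.get 1 (.add (.get 5 (.reg 2)) (.get 7 (.reg 2)))))
        (.seq (.put 4 (.reg 2) (.add (.reg 6) (.const 1))) (.put 9 (.reg 6) (.const 1))))
      .skip)
    (incr 2)

def output : Cmd := .seq (.assign 2 (.const 0)) (.loop (.sub (.reg 0) (.reg 2)) outputPair)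

def checkAgent : Cmd :=
  .seq (.cond (.sub (.add (.get 2 (.reg 2)) (.const 1)) (.get 8 (.reg 2)))
      (.cond (.get 9 (.reg 2)) .skip (.assign 10 (.const 0))) .skip)
    (incr 2)

/-- Test whether all agents in `W` that must be matched are matched. -/
def check : Cmd :=
  .seq (.seq (.assign 2 (.const 0)) (.assign 10 (.const 1)))
    (.seq (.loop (.sub (.reg 0) (.reg 2)) checkAgent) (.assign 0 (.reg 10)))

/-- The program that finds a robust matching. -/
def robustProgram : Cmd := .seq setup (.seq relaxAll (.seq output check))

/-! ## Memory layout -/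

/-- Distinct cells of an `n × n` table have distinct addresses, so writing one entry leaves the
others intact. -/
theorem mul_add_inj {a b c d : ℕ} (hb : b < n) (hd : d < n) (h : a * n + b = c * n + d) :
    a = c ∧ b = d := by
  have h1 : (a * n + b) / n = a := by
    rw [mul_comm, Nat.mul_add_div (by omega), Nat.div_eq_of_lt hb, add_zero]
  have h2 : (c * n + d) / n = c := by
    rw [mul_comm, Nat.mul_add_div (by omega), Nat.div_eq_of_lt hd, add_zero]
  obtain rfl : a = c := by rw [← h1, h, h2]
  exact ⟨rfl, by omega⟩

theorem entryArray_apply (L : Fin n → List (Fin n)) (hL : ∀ u, (L u).Nodup) (u : Fin n) {k : ℕ}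
    (hk : k < (L u).length) : entryArray L (u * n + k) = (L u)[k] := by
  have hkn : k < n := hk.trans_le (length_le_of_nodup (hL u))
  have h1 : (u * n + k) / n = u := by
    rw [mul_comm, Nat.mul_add_div (by omega), Nat.div_eq_of_lt hkn, add_zero]
  have h2 : (u * n + k) % n = k := by
    rw [mul_comm, Nat.mul_add_mod, Nat.mod_eq_of_lt hkn]
  unfold entryArray
  simp [h1, h2, hk]

/-- The cells that hold the input and the tables. -/
structure HasTables (P : Profile n) (d : ℕ) (s : State) : Prop where
  reg_n : s.reg 0 = n
  reg_d : s.reg 1 = d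
  lenU : ∀ u : Fin n, s.arr 0 u = (P.listU u).length
  entU : ∀ (u : Fin n) (k : ℕ) (hk : k < (P.listU u).length),
    s.arr 1 (u * n + k) = (P.listU u)[k]
  lenW : ∀ w : Fin n, s.arr 2 w = (P.listW w).length
  base : ∀ i : Fin n, s.arr 5 i = i * n
  ranks : ∀ w u : Fin n, s.arr 6 (w * n + u) =
    if u ∈ P.listW w then rank (P.listW w) u + 1 else 0

theorem HasTables.of_eq {P : Profile n} {d : ℕ} {s s' : State} (h : HasTables P d s)
    (h0 : s'.reg 0 = s.reg 0) (h1 : s'.reg 1 = s.reg 1) (a0 : s'.arr 0 = s.arr 0)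
    (a1 : s'.arr 1 = s.arr 1) (a2 : s'.arr 2 = s.arr 2) (a5 : s'.arr 5 = s.arr 5)
    (a6 : s'.arr 6 = s.arr 6) : HasTables P d s' := by
  obtain ⟨_, _, _, _, _, _, _⟩ := h
  constructor <;> simpa only [h0, h1, a0, a1, a2, a5, a6]

/-- The memory during the relaxation: the tables, the bounds, and empty cells for the output. -/
structure HasBounds (P : Profile n) (d : ℕ) (A T : Fin n → ℕ) (s : State) : Prop where
  tables : HasTables P d s
  arr_A : ∀ u : Fin n, s.arr 7 u = A u
  arr_T : ∀ w : Fin n, s.arr 8 w = T w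
  out : ∀ u : ℕ, s.arr 4 u = 0
  marks : ∀ w : ℕ, s.arr 9 w = 0

theorem HasBounds.of_eq {P : Profile n} {d : ℕ} {A T : Fin n → ℕ} {s s' : State}
    (h : HasBounds P d A T s) (h0 : s'.reg 0 = s.reg 0) (h1 : s'.reg 1 = s.reg 1)
    (ha : s'.arr = s.arr) : HasBounds P d A T s' := by
  refine ⟨h.tables.of_eq h0 h1 ?_ ?_ ?_ ?_ ?_, ?_, ?_, ?_, ?_⟩ <;> simp only [ha]
  exacts [h.arr_A, h.arr_T, h.out, h.marks]

theorem update_apply_val (f : ℕ → ℕ) (g : Fin n → ℕ) (h : ∀ i : Fin n, f i = g i) (j : Fin n)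
    (v : ℕ) (i : Fin n) : Function.update f j v i = Function.update g j v i := by
  by_cases hij : i = j
  · subst hij; simp
  · rw [Function.update_of_ne hij, Function.update_of_ne (fun h' => hij (Fin.ext h')), h]

theorem HasBounds.update_A {P : Profile n} {d : ℕ} {A T : Fin n → ℕ} {s s' : State}
    (h : HasBounds P d A T s) (u : Fin n) (v : ℕ) (h0 : s'.reg 0 = s.reg 0)
    (h1 : s'.reg 1 = s.reg 1)
    (ha : s'.arr = Function.update s.arr 7 (Function.update (s.arr 7) u v)) :
    HasBounds P d (Function.update A u v) T s' := by
  refine ⟨h.tables.of_eq h0 h1 ?_ ?_ ?_ ?_ ?_, ?_, ?_, ?_, ?_⟩ <;> simp [ha]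
  exacts [update_apply_val _ _ h.arr_A _ _, h.arr_T, h.out, h.marks]

theorem HasBounds.update_T {P : Profile n} {d : ℕ} {A T : Fin n → ℕ} {s s' : State}
    (h : HasBounds P d A T s) (w : Fin n) (v : ℕ) (h0 : s'.reg 0 = s.reg 0)
    (h1 : s'.reg 1 = s.reg 1)
    (ha : s'.arr = Function.update s.arr 8 (Function.update (s.arr 8) w v)) :
    HasBounds P d A (Function.update T w v) s' := by
  refine ⟨h.tables.of_eq h0 h1 ?_ ?_ ?_ ?_ ?_, ?_, ?_, ?_, ?_⟩ <;> simp [ha]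
  exacts [h.arr_A, update_apply_val _ _ h.arr_T _ _, h.out, h.marks]

/-! ## Correctness of the preparation -/

/-- The memory after `j` list entries of agent `i` have been entered into the table of ranks. -/
structure SetupInv (P : Profile n) (d i j : ℕ) (s : State) : Prop where
  reg_n : s.reg 0 = n
  reg_d : s.reg 1 = d
  reg_i : s.reg 2 = i
  reg_base : s.reg 3 = i * n
  frame : ∀ a, a ≠ 5 → a ≠ 6 → a ≠ 8 → s.arr a = (inputState P d).arr a
  base : ∀ w : Fin n, w < i → s.arr 5 w = w * n
  arr_T : ∀ w : Fin n, w < i → s.arr 8 w = (P.listW w).length + 1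
  ranks : ∀ w u : Fin n, s.arr 6 (w * n + u) =
    if u ∈ P.listW w ∧ (w < i ∨ w = i ∧ rank (P.listW w) u < j) then rank (P.listW w) u + 1 else 0

/-- The inverse table makes rank queries constant-time, and the row addresses are built up by
additions, as there is no multiplication. The zero bounds for `U` need no initialisation. -/
theorem setup_runs (P : Profile n) (d : ℕ) :
    Runs setup (inputState P d) ((n + 1) ^ 2 * 100)
      (HasBounds P d (fun _ => 0) fun w => (P.listW w).length + 1) := by
  have hlenW : ∀ w : Fin n, (inputState P d).arr 2 w = (P.listW w).length := fun w => by
    simp [inputState, lengthArray]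
  have key : Runs setup (inputState P d) ((n + 1) * (3 + 1 + (n + 1) * 95)) (SetupInv P d n 0) := by
    refine Runs.count (fun i s => SetupInv P d i 0 s) ?_ ?_ _ ?_
    · intro k s hk h
      simp only [Expr.eval, h.reg_n, h.reg_i]
      omega
    · intro i s hi h
      let w : Fin n := ⟨i, hi⟩
      have hl : (P.listW w).length ≤ n := length_le_of_nodup (P.nodupW w)
      have h2 : s.arr 2 i = (P.listW w).length := by
        rw [h.frame 2 (by decide) (by decide) (by decide)]; exact hlenW w
      let I : ℕ → State → Prop := fun j s => SetupInv P d i j s ∧ s.reg 4 = j ∧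
        s.arr 5 i = i * n ∧ s.arr 8 i = (P.listW w).length + 1
      have hhead : Runs setupHead s 20 (I 0) := by
        refine (Runs.of_loopFree (Q := I 0) (by simp [setupHead, Cmd.LoopFree]) ?_).mono
          (by simp [setupHead, Cmd.time, Expr.cost]) fun _ h => h
        refine ⟨?_, ?_, ?_, ?_⟩
        · obtain ⟨g0, g1, g2, g3, gf, gb, gT, gr⟩ := h
          constructor <;>
            simp [setupHead, Cmd.run, State.setReg, State.setArr, Expr.eval, Function.update_apply,
              g0, g1, g2, g3]
          · intro a h5 h6 h8
            simp [h5, h8, gf a h5 h6 h8]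
          · intro w hw
            simp [hw.ne, gb w hw]
          · intro w hw
            simp [hw.ne, gT w hw]
          · simpa using gr
        all_goals
          simp [setupHead, Cmd.run, State.setReg, State.setArr, Expr.eval, h.reg_i, h.reg_base,
            h2]
      have hloop : ∀ s, I 0 s → Runs (.loop (.sub (.get 2 (.reg 2)) (.reg 4)) setRank) s
          ((n + 1) * 40) (I (P.listW w).length) := by
        intro s hs
        refine (Runs.count (K := 30) I ?_ ?_ s hs).mono ?_ fun _ h => h
        · rintro j s hj ⟨h, h4, -⟩
          have h2 : s.arr 2 i = (P.listW w).length := by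
            rw [h.frame 2 (by decide) (by decide) (by decide)]; exact hlenW w
          simp only [Expr.eval, h.reg_i, h4, h2]
          omega
        · rintro j s hj ⟨h, h4, h5, h8⟩
          refine (Runs.of_loopFree (Q := I (j + 1)) (by simp [setRank, incr, Cmd.LoopFree]) ?_).mono
            (by simp [setRank, incr, Cmd.time, Expr.cost]) fun _ h => h
          have he : s.arr 3 (i * n + j) = (P.listW w)[j] := by
            rw [h.frame 3 (by decide) (by decide) (by decide)]
            exact entryArray_apply P.listW P.nodupW w hj
          obtain ⟨g0, g1, g2, g3, gf, gb, gT, gr⟩ := h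
          refine ⟨?_, ?_, ?_, ?_⟩
          · constructor <;>
              simp [setRank, incr, Cmd.run, State.setReg, State.setArr, Expr.eval,
                Function.update_apply, g0, g1, g2, g3]
            · intro a h5 h6 h8
              simp [h6, gf a h5 h6 h8]
            · exact gb
            · exact gT
            · intro v u
              rw [h4, he, gr]
              have hr : rank (P.listW w) (P.listW w)[j] = j := rank_getElem (P.nodupW w) hj
              have hm : (P.listW w)[j] ∈ P.listW w := List.getElem_mem _
              by_cases hvu : v = w ∧ u = (P.listW w)[j]
              · obtain ⟨rfl, rfl⟩ := hvu
                simp [w, hm, hr]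
              -- Every other cell keeps its value, and its description is unchanged because no other
              -- agent has rank `j` in this row.
              · rw [if_neg fun h => hvu ?_]
                · refine if_congr (and_congr_right fun hu => or_congr_right
                    (and_congr_right fun hv => ?_)) rfl rfl
                  obtain rfl : v = w := Fin.ext hv
                  have : rank (P.listW w) u ≠ j := fun h =>
                    hvu ⟨rfl, rank_inj hu (h.trans hr.symm)⟩
                  omega
                · obtain ⟨h1, h2⟩ := mul_add_inj u.2 (P.listW w)[j].2 h
                  exact ⟨Fin.ext h1, Fin.ext h2⟩
          all_goals
            simp [setRank, incr, Cmd.run, State.setReg, State.setArr, Expr.eval, h4, h5,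
              h8]
        · simp only [Expr.cost]
          gcongr
          norm_num
      have hnext : ∀ s, I (P.listW w).length s → Runs nextRow s 20 (SetupInv P d (i + 1) 0) := by
        rintro s ⟨⟨g0, g1, g2, g3, gf, gb, gT, gr⟩, h4, h5, h8⟩
        refine (Runs.of_loopFree (Q := SetupInv P d (i + 1) 0)
          (by simp [nextRow, incr, Cmd.LoopFree]) ?_).mono
          (by simp [nextRow, incr, Cmd.time, Expr.cost]) fun _ h => h
        constructor <;>
          simp [nextRow, incr, Cmd.run, State.setReg, Expr.eval, g0, g1, g2, g3]
        · ring
        · exact gf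
        · intro v hv
          rcases hv.lt_or_eq with hv | hv
          · exact gb v hv
          · rw [hv, h5]
        · intro v hv
          rcases hv.lt_or_eq with hv | hv
          · exact gT v hv
          · obtain rfl : v = w := Fin.ext hv
            exact h8
        · intro v u
          rw [gr]
          refine if_congr (and_congr_right fun hu => ?_) rfl rfl
          have hr : v = w → rank (P.listW v) u < (P.listW w).length := by
            rintro rfl
            exact rank_lt_length.2 hu
          have hvw : (v : ℕ) = i → v = w := fun h => Fin.ext h
          omega
      refine (hhead.seq fun s hs => (hloop s hs).seq hnext).mono ?_ fun _ h => h
      omega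
    · constructor <;> simp [inputState]
  refine key.mono ?_ fun s h => ?_
  · nlinarith
  · have hf : ∀ a, a ≠ 5 → a ≠ 6 → a ≠ 8 → s.arr a = (inputState P d).arr a := h.frame
    refine ⟨⟨h.reg_n, h.reg_d, ?_, ?_, ?_, fun i => h.base i i.2, ?_⟩, ?_, fun w => h.arr_T w w.2,
      ?_, ?_⟩
    · intro u
      rw [hf 0 (by decide) (by decide) (by decide)]
      simp [inputState, lengthArray]
    · intro u k hk
      rw [hf 1 (by decide) (by decide) (by decide)]
      exact entryArray_apply P.listU P.nodupU u hk
    · intro w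
      rw [hf 2 (by decide) (by decide) (by decide), hlenW]
    · intro w u
      rw [h.ranks]
      simp
    all_goals
      intro u
      rw [hf _ (by decide) (by decide) (by decide)]
      simp [inputState]

/-! ## Correctness of the relaxation -/

/-- The amount by which the bounds can still improve. -/
def slack (P : Profile n) (A T : Fin n → ℕ) : ℕ :=
  ∑ u, ((P.listU u).length - A u) + ∑ w, T w

theorem slack_mono {P : Profile n} {A A' T T' : Fin n → ℕ} (hA : ∀ u, A u ≤ A' u)
    (hT : ∀ w, T' w ≤ T w) : slack P A' T' ≤ slack P A T :=
  Nat.add_le_add (Finset.sum_le_sum fun u _ => Nat.sub_le_sub_left (hA u) _)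
    (Finset.sum_le_sum fun w _ => hT w)

/-- The hypothesis `hle` makes an increase of a bound in `U` visible through the truncated
subtraction. -/
theorem slack_lt {P : Profile n} {A A' T T' : Fin n → ℕ} (hA : ∀ u, A u ≤ A' u)
    (hT : ∀ w, T' w ≤ T w) (hle : ∀ u, A' u ≤ (P.listU u).length)
    (hne : (∃ u, A u ≠ A' u) ∨ ∃ w, T' w ≠ T w) : slack P A' T' < slack P A T := by
  rcases hne with ⟨u, hu⟩ | ⟨w, hw⟩
  · refine Nat.add_lt_add_of_lt_of_le
      (Finset.sum_lt_sum (fun u _ => Nat.sub_le_sub_left (hA u) _) ⟨u, Finset.mem_univ u, ?_⟩)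
      (Finset.sum_le_sum fun w _ => hT w)
    have := hA u
    have := hle u
    omega
  · exact Nat.add_lt_add_of_le_of_lt
      (Finset.sum_le_sum fun u _ => Nat.sub_le_sub_left (hA u) _)
      (Finset.sum_lt_sum (fun w _ => hT w) ⟨w, Finset.mem_univ w, (hT w).lt_of_ne hw⟩)

theorem IsBound.slack_le {P : Profile n} {d : ℕ} {A T : Fin n → ℕ} (h : IsBound P d A T) :
    slack P A T ≤ n * n + n * (n + 1) := by
  refine Nat.add_le_add ?_ ?_
  · refine (Finset.sum_le_card_nsmul _ _ n fun u _ => ?_).trans (by simp)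
    exact (Nat.sub_le _ _).trans (length_le_of_nodup (P.nodupU u))
  · refine (Finset.sum_le_card_nsmul _ _ (n + 1) fun w _ => ?_).trans (by simp)
    exact (h.le_length_succ w).trans (Nat.succ_le_succ (length_le_of_nodup (P.nodupW w)))

section RelaxPair

variable {P : Profile n} {d : ℕ} {A T : Fin n → ℕ} {s : State} {u w : Fin n}

/-- The registers while the pair `(u, w)` is processed, with the bounds `a` for `u` and `t` for `w`
in the memory. -/
structure PairInv (P : Profile n) (A T : Fin n → ℕ) (u w : Fin n) (s : State) : Prop where
  reg_u : s.reg 2 = u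
  reg_base : s.reg 3 = u * n
  reg_k : s.reg 4 = rank (P.listU u) w
  reg_w : s.reg 6 = w
  reg_r : s.reg 7 = if u ∈ P.listW w then rank (P.listW w) u + 1 else 0
  reg_T : s.reg 8 = T w
  reg_A : s.reg 9 = A u

/-- The program does not form the minimum with `T w`: the later store takes place only if it lowers
the bound. The disjunction in `relaxT` is tested as a sum of truncated differences, and the `- 1`
offsets the shift in the stored ranks. -/
theorem newBound_run (h1 : s.reg 1 = d) (hs : PairInv P A T u w s) :
    ∃ v, newBound.run s = s.setReg 10 v ∧ min (T w) v = relaxT P d A T u w := by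
  obtain ⟨-, -, g4, -, g7, g8, g9⟩ := hs
  unfold relaxT
  by_cases hac : u ∈ P.listW w
  · rw [if_pos hac] at g7 ⊢
    by_cases hc : rank (P.listU u) w < A u ∨ T w ≤ rank (P.listW w) u
    · rw [if_pos hc]
      have : ¬ (A u - rank (P.listU u) w = 0 ∧ rank (P.listW w) u + 1 - T w = 0) := by omega
      refine ⟨rank (P.listW w) u + 1 + (rank (P.listU u) w - A u) - 1 - d, ?_, by omega⟩
      simp [newBound, Cmd.run, Expr.eval, h1, g4, g7, g8, g9, this]
    · rw [if_neg hc]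
      have : A u - rank (P.listU u) w = 0 ∧ rank (P.listW w) u + 1 - T w = 0 := by omega
      by_cases hd : rank (P.listU u) w - A u ≤ d
      · rw [if_pos hd]
        have hd' : rank (P.listU u) w - A u - d = 0 := by omega
        refine ⟨rank (P.listW w) u + 1, ?_, rfl⟩
        simp [newBound, Cmd.run, Expr.eval, h1, g4, g7, g8, g9, this, hd']
      · rw [if_neg hd]
        have hd' : rank (P.listU u) w - A u - d ≠ 0 := by omega
        refine ⟨T w, ?_, min_self _⟩
        simp [newBound, Cmd.run, Expr.eval, h1, g4, g7, g8, g9, this, hd']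
  · rw [if_neg hac] at g7 ⊢
    exact ⟨T w, by simp [newBound, Cmd.run, Expr.eval, g7, g8], min_self _⟩

theorem loadPair_runs (h : HasBounds P d A T s) (hw : w ∈ P.listU u) (h2 : s.reg 2 = u)
    (h3 : s.reg 3 = u * n) (h4 : s.reg 4 = rank (P.listU u) w) :
    Runs loadPair s 100 fun s' => HasBounds P d A T s' ∧ PairInv P A T u w s' ∧
      s'.reg 5 = s.reg 5 ∧ min (T w) (s'.reg 10) = relaxT P d A T u w := by
  refine Runs.mono (Runs.of_loopFree (by simp [loadPair, fetchPair, newBound, Cmd.LoopFree]) ?_)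
    (by simp [loadPair, fetchPair, newBound, Cmd.time, Expr.cost]) fun _ h => h
  have he : s.arr 1 (u * n + rank (P.listU u) w) = w := by
    rw [h.tables.entU u _ (rank_lt_length.2 hw), getElem_rank]
  have hs : PairInv P A T u w (fetchPair.run s) := by
    constructor <;> simp [fetchPair, Cmd.run, State.setReg, Expr.eval, h2, h3, h4, he,
      h.tables.ranks, h.tables.base, h.arr_A, h.arr_T]
  have hb : HasBounds P d A T (fetchPair.run s) := h.of_eq rfl rfl rfl
  obtain ⟨v, hrun, hv⟩ := newBound_run hb.tables.reg_d hs
  have hrun' : loadPair.run s = (fetchPair.run s).setReg 10 v := hrun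
  rw [hrun']
  obtain ⟨g2, g3, g4, g6, g7, g8, g9⟩ := hs
  refine ⟨hb.of_eq rfl rfl rfl, by constructor <;> simpa [State.setReg], rfl, ?_⟩
  simpa [State.setReg] using hv

theorem storeT_runs (h : HasBounds P d A T s) (hs : PairInv P A T u w s) (h5 : s.reg 5 ≤ 1)
    (h10 : min (T w) (s.reg 10) = relaxT P d A T u w) :
    Runs storeT s 20 fun s' =>
      HasBounds P d A (Function.update T w (relaxT P d A T u w)) s' ∧
      PairInv P A (Function.update T w (relaxT P d A T u w)) u w s' ∧ s'.reg 5 ≤ 1 ∧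
      (s'.reg 5 = 0 ↔ s.reg 5 = 0 ∧ relaxT P d A T u w = T w) := by
  refine Runs.mono (Runs.of_loopFree (by simp [storeT, Cmd.LoopFree]) ?_)
    (by simp [storeT, Cmd.time, Expr.cost]) fun _ h => h
  obtain ⟨g2, g3, g4, g6, g7, g8, g9⟩ := hs
  by_cases heq : relaxT P d A T u w = T w
  · have hrun : storeT.run s = s := by
      have : T w - s.reg 10 = 0 := by omega
      simp [storeT, Cmd.run, Expr.eval, g8, this]
    rw [hrun, heq, Function.update_eq_self]
    exact ⟨h, ⟨g2, g3, g4, g6, g7, g8, g9⟩, h5, by simp⟩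
  · have hrun : storeT.run s = ((s.setArr 8 w (relaxT P d A T u w)).setReg 8
        (relaxT P d A T u w)).setReg 5 1 := by
      have h10' : s.reg 10 = relaxT P d A T u w := by omega
      have : T w - relaxT P d A T u w ≠ 0 := by omega
      simp [storeT, Cmd.run, Expr.eval, g8, h10', g6, this, State.setArr]
    rw [hrun]
    refine ⟨h.update_T w _ rfl rfl rfl, ?_, ?_, ?_⟩
    · constructor <;> simp [State.setReg, State.setArr, *]
    · simp [State.setReg]
    · simp [State.setReg, heq]

/-- Equality of the rank with `A u` is tested by adding both truncated differences; register `11`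
vanishes exactly if the pair is unacceptable to `w` or excluded by `T w`. -/
theorem storeA_runs (h : HasBounds P d A T s) (hs : PairInv P A T u w s) (h5 : s.reg 5 ≤ 1) :
    Runs storeA s 40 fun s' =>
      HasBounds P d (Function.update A u (relaxA P A T u w)) T s' ∧ s'.reg 2 = u ∧
      s'.reg 3 = u * n ∧ s'.reg 4 = rank (P.listU u) w + 1 ∧ s'.reg 5 ≤ 1 ∧
      (s'.reg 5 = 0 ↔ s.reg 5 = 0 ∧ relaxA P A T u w = A u) := by
  refine Runs.mono (Runs.of_loopFree (by simp [storeA, incr, Cmd.LoopFree]) ?_)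
    (by simp [storeA, incr, Cmd.time, Expr.cost]) fun _ h => h
  obtain ⟨g2, g3, g4, g6, g7, g8, g9⟩ := hs
  obtain ⟨v, hv, hrun⟩ : ∃ v, (v = 0 ↔ (u ∈ P.listW w → T w ≤ rank (P.listW w) u)) ∧
      storeA.run s = (incr 4).run (if rank (P.listU u) w - A u + (A u - rank (P.listU u) w) + v ≠ 0
        then s.setReg 11 v else ((s.setReg 11 v).setArr 7 u (A u + 1)).setReg 5 1) := by
    by_cases hac : u ∈ P.listW w
    · rw [if_pos hac] at g7
      refine ⟨T w + 1 - (rank (P.listW w) u + 1), by simp [hac]; omega, ?_⟩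
      simp [storeA, Cmd.run, Expr.eval, State.setReg, State.setArr, g2, g4, g7, g8, g9]
    · rw [if_neg hac] at g7
      refine ⟨0, by simp [hac], ?_⟩
      simp [storeA, Cmd.run, Expr.eval, State.setReg, State.setArr, g2, g4, g7, g9]
  rw [hrun]
  unfold relaxA
  by_cases hc : rank (P.listU u) w = A u ∧ (u ∈ P.listW w → T w ≤ rank (P.listW w) u)
  · rw [if_pos hc, if_neg (by rw [← hv] at hc; omega)]
    refine ⟨h.update_A u _ rfl rfl rfl, ?_⟩
    simp [incr, Cmd.run, Expr.eval, State.setReg, State.setArr, g2, g3, g4]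
  · rw [if_neg hc, if_pos (by rw [← hv] at hc; omega), Function.update_eq_self]
    refine ⟨h.of_eq rfl rfl rfl, ?_⟩
    simp [incr, Cmd.run, Expr.eval, State.setReg, g2, g3, g4, h5]

end RelaxPair

/-- The memory during a scan that started with the bounds `A₀` and `T₀`, after the pairs in `D` have
been processed: register `5` tells whether the bounds have changed. -/
def ScanInv (P : Profile n) (d : ℕ) (A₀ T₀ : Fin n → ℕ) (D : Fin n → Fin n → Prop) (s : State) :
    Prop :=
  ∃ A T, HasBounds P d A T s ∧ IsBound P d A T ∧ s.reg 5 ≤ 1 ∧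
    (s.reg 5 = 0 → A = A₀ ∧ T = T₀ ∧ ∀ u, ∀ w ∈ P.listU u, D u w → IsRelaxed P d A₀ T₀ u w) ∧
    (s.reg 5 ≠ 0 → slack P A T < slack P A₀ T₀)

theorem relaxPair_runs {P : Profile n} {d : ℕ} {A₀ T₀ : Fin n → ℕ} {D D' : Fin n → Fin n → Prop}
    {s : State} {u w : Fin n} (hs : ScanInv P d A₀ T₀ D s) (hw : w ∈ P.listU u)
    (h2 : s.reg 2 = u) (h3 : s.reg 3 = u * n) (h4 : s.reg 4 = rank (P.listU u) w)
    (hD : ∀ u', ∀ w' ∈ P.listU u', D' u' w' → D u' w' ∨ u' = u ∧ w' = w) :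
    Runs relaxPair s 160 fun s' => ScanInv P d A₀ T₀ D' s' ∧ s'.reg 2 = u ∧ s'.reg 3 = u * n ∧
      s'.reg 4 = rank (P.listU u) w + 1 := by
  obtain ⟨A, T, hm, hb, h5, hz, hnz⟩ := hs
  refine ((loadPair_runs hm hw h2 h3 h4).seq fun s₁ hs₁ =>
    (storeT_runs hs₁.1 hs₁.2.1 (hs₁.2.2.1.trans_le h5) hs₁.2.2.2).seq
      fun s₂ hs₂ => (storeA_runs hs₂.1 hs₂.2.1 hs₂.2.2.1).mono (Q' := fun s' =>
        ScanInv P d A₀ T₀ D' s' ∧ s'.reg 2 = u ∧ s'.reg 3 = u * n ∧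
          s'.reg 4 = rank (P.listU u) w + 1) le_rfl ?_).mono le_rfl fun _ h => h
  rintro s₃ ⟨hm', g2, g3, g4, g5, gz⟩
  refine ⟨⟨_, _, hm', (hb.update_relaxT u hw).update_relaxA hw, g5, ?_, ?_⟩, g2, g3, g4⟩
  all_goals rw [hs₂.2.2.2, hs₁.2.2.1] at gz
  · rw [gz]
    rintro ⟨⟨h0, hT⟩, hA⟩
    -- The rule for `U` ran with the bound just stored for `w`; as that bound did not change, both
    -- rules were tested against the same bounds.
    rw [hT, Function.update_eq_self] at hA
    rw [hT, Function.update_eq_self, hA, Function.update_eq_self]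
    obtain ⟨rfl, rfl, hrel⟩ := hz h0
    refine ⟨rfl, rfl, fun u' w' hw' hd => ?_⟩
    rcases hD u' w' hw' hd with hd | ⟨rfl, rfl⟩
    · exact hrel u' w' hw' hd
    · exact ⟨hT, hA⟩
  · rw [ne_eq, gz]
    intro hne
    have hA : ∀ v, A v ≤ Function.update A u
        (relaxA P A (Function.update T w (relaxT P d A T u w)) u w) v := fun v => by
      by_cases hv : v = u
      · subst hv
        rw [Function.update_self]
        exact le_relaxA ..
      · rw [Function.update_of_ne hv]
    have hT : ∀ v, Function.update T w (relaxT P d A T u w) v ≤ T v := fun v => by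
      by_cases hv : v = w
      · subst hv
        rw [Function.update_self]
        exact relaxT_le ..
      · rw [Function.update_of_ne hv]
    -- Either this is the first change in the scan, and it lowers the slack, or the slack was
    -- already lower and does not grow.
    by_cases h0 : s.reg 5 = 0
    · obtain ⟨rfl, rfl, -⟩ := hz h0
      refine slack_lt hA hT ((hb.update_relaxT u hw).update_relaxA hw).le_length ?_
      by_cases hTw : relaxT P d A T u w = T w
      · refine Or.inl ⟨u, ?_⟩
        rw [Function.update_self]
        exact fun h => hne ⟨⟨h0, hTw⟩, h.symm⟩
      · exact Or.inr ⟨w, by rwa [Function.update_self]⟩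
    · exact (slack_mono hA hT).trans_lt (hnz h0)

theorem ScanInv.of_eq {P : Profile n} {d : ℕ} {A₀ T₀ : Fin n → ℕ} {D D' : Fin n → Fin n → Prop}
    {s s' : State} (hs : ScanInv P d A₀ T₀ D s) (h0 : s'.reg 0 = s.reg 0)
    (h1 : s'.reg 1 = s.reg 1) (h5 : s'.reg 5 = s.reg 5) (ha : s'.arr = s.arr)
    (hD : ∀ u, ∀ w ∈ P.listU u, D' u w → D u w) : ScanInv P d A₀ T₀ D' s' := by
  obtain ⟨A, T, hm, hb, hle, hz, hnz⟩ := hs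
  refine ⟨A, T, hm.of_eq h0 h1 ha, hb, h5 ▸ hle, fun h => ?_, fun h => hnz (h5 ▸ h)⟩
  obtain ⟨rfl, rfl, hr⟩ := hz (h5 ▸ h)
  exact ⟨rfl, rfl, fun u w hw hd => hr u w hw (hD u w hw hd)⟩

/-- If the flag is still clear at the end, all pairs were tested against the same, unchanged bounds,
which is what makes them a common fixpoint. -/
theorem scan_runs {P : Profile n} {d : ℕ} {A₀ T₀ : Fin n → ℕ} {s : State}
    (hs : ScanInv P d A₀ T₀ (fun _ _ => False) s) (h2 : s.reg 2 = 0) (h3 : s.reg 3 = 0) :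
    Runs scan s ((n + 1) ^ 2 * 300) (ScanInv P d A₀ T₀ fun _ _ => True) := by
  have hreg0 : ∀ {D s}, ScanInv P d A₀ T₀ D s → s.reg 0 = n := fun h => by
    obtain ⟨A, T, hm, -⟩ := h
    exact hm.tables.reg_n
  have hlenU : ∀ {D s}, ScanInv P d A₀ T₀ D s → ∀ u : Fin n, s.arr 0 u = (P.listU u).length :=
    fun h => by
      obtain ⟨A, T, hm, -⟩ := h
      exact hm.tables.lenU
  refine Runs.mono (T := (n + 1) * (3 + 1 + (n + 1) * 200)) (Runs.count (fun i s =>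
      ScanInv P d A₀ T₀ (fun u _ => u < i) s ∧ s.reg 2 = i ∧ s.reg 3 = i * n) ?_ ?_ _ ?_) ?_ ?_
  · rintro k s hk ⟨h, h2, h3⟩
    simp only [Expr.eval, hreg0 h, h2]
    omega
  · rintro i s hi ⟨h, h2, h3⟩
    let u : Fin n := ⟨i, hi⟩
    have hl : (P.listU u).length ≤ n := length_le_of_nodup (P.nodupU u)
    let J : ℕ → State → Prop := fun k s =>
      ScanInv P d A₀ T₀ (fun v w => v < i ∨ v = u ∧ rank (P.listU v) w < k) s ∧ s.reg 2 = i ∧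
        s.reg 3 = i * n ∧ s.reg 4 = k
    have hhead : Runs (.assign 4 (.const 0)) s 5 (J 0) := by
      refine Runs.mono (Runs.of_loopFree trivial ?_) (by simp [Cmd.time, Expr.cost]) fun _ h => h
      refine ⟨h.of_eq rfl rfl rfl rfl ?_, ?_⟩
      · simp
      · simp [Cmd.run, State.setReg, Expr.eval, h2, h3]
    have hloop : ∀ s, J 0 s → Runs (.loop (.sub (.get 0 (.reg 2)) (.reg 4)) relaxPair) s
        ((n + 1) * 170) (J (P.listU u).length) := by
      intro s hs
      refine (Runs.count (K := 160) J ?_ ?_ s hs).mono ?_ fun _ h => h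
      · rintro k s hk ⟨h, g2, g3, g4⟩
        have hlen : s.arr 0 i = _ := hlenU h u
        simp only [Expr.eval, g2, g4, hlen]
        omega
      · rintro k s hk ⟨h, g2, g3, g4⟩
        have hr : rank (P.listU u) (P.listU u)[k] = k := rank_getElem (P.nodupU u) hk
        have hm : (P.listU u)[k] ∈ P.listU u := List.getElem_mem _
        refine (relaxPair_runs (D' := fun v w => v < i ∨ v = u ∧ rank (P.listU v) w < k + 1) h hm
          g2 g3 (g4.trans hr.symm) ?_).mono le_rfl ?_
        · rintro v w hw (hd | ⟨rfl, hd⟩)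
          · exact Or.inl (Or.inl hd)
          · rcases (Nat.lt_succ_iff.1 hd).lt_or_eq with hd | hd
            · exact Or.inl (Or.inr ⟨rfl, hd⟩)
            · exact Or.inr ⟨rfl, rank_inj hw (hd.trans hr.symm)⟩
        · rw [hr]
          exact fun _ h => h
      · simp only [Expr.cost]
        gcongr
        norm_num
    have hnext : ∀ s, J (P.listU u).length s → Runs nextRow s 20 fun s =>
        ScanInv P d A₀ T₀ (fun v _ => v < i + 1) s ∧ s.reg 2 = i + 1 ∧ s.reg 3 = (i + 1) * n := by
      rintro s ⟨h, g2, g3, g4⟩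
      refine Runs.mono (Runs.of_loopFree (by simp [nextRow, incr, Cmd.LoopFree]) ?_)
        (by simp [nextRow, incr, Cmd.time, Expr.cost]) fun _ h => h
      refine ⟨h.of_eq rfl rfl rfl rfl ?_, ?_⟩
      · intro v w hw hv
        rcases (Nat.lt_succ_iff.1 hv).lt_or_eq with hv | hv
        · exact Or.inl hv
        · exact Or.inr ⟨Fin.ext hv, by
            obtain rfl : v = u := Fin.ext hv
            exact rank_lt_length.2 hw⟩
      · simp [nextRow, incr, Cmd.run, State.setReg, Expr.eval, g2, g3, hreg0 h, add_mul]
    refine (hhead.seq fun s hs => (hloop s hs).seq hnext).mono ?_ fun _ h => h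
    omega
  · refine ⟨hs.of_eq rfl rfl rfl rfl ?_, h2, by simp [h3]⟩
    simp
  · nlinarith
  · rintro s ⟨h, -⟩
    exact h.of_eq rfl rfl rfl rfl fun u _ _ _ => u.2

theorem relaxAll_runs {P : Profile n} {d : ℕ} {A T : Fin n → ℕ} {s : State}
    (hs : HasBounds P d A T s) (hb : IsBound P d A T) :
    Runs relaxAll s ((n + 1) ^ 4 * 2000) fun s' => ∃ A T, HasBounds P d A T s' ∧ IsBound P d A T ∧
      ∀ u, ∀ w ∈ P.listU u, IsRelaxed P d A T u w := by
  let I : State → Prop := fun s => ∃ A T, HasBounds P d A T s ∧ IsBound P d A T ∧ s.reg 5 ≤ 1 ∧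
    (s.reg 5 = 0 → ∀ u, ∀ w ∈ P.listU u, IsRelaxed P d A T u w)
  -- Adding the flag makes the last scan decrease the measure too: it leaves the slack alone but
  -- clears the flag.
  let μ : State → ℕ := fun s => slack P (fun u => s.arr 7 u) (fun w => s.arr 8 w) + s.reg 5
  have hμ : ∀ {A T s}, HasBounds P d A T s → μ s = slack P A T + s.reg 5 := fun h => by
    simp only [μ, h.arr_A, h.arr_T]
  have hfirst : Runs (.assign 5 (.const 1)) s 5 fun s => I s ∧ μ s ≤ n * n + n * (n + 1) + 1 := by
    refine Runs.mono (Runs.of_loopFree trivial ?_) (by simp [Cmd.time, Expr.cost]) fun _ h => h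
    have hs' : HasBounds P d A T (Cmd.run (.assign 5 (.const 1)) s) := hs.of_eq rfl rfl rfl
    have h5 : (Cmd.run (.assign 5 (.const 1)) s).reg 5 = 1 := by
      simp [Cmd.run, State.setReg, Expr.eval]
    refine ⟨⟨A, T, hs', hb, h5.le, by simp [h5]⟩, ?_⟩
    rw [hμ hs', h5]
    exact Nat.succ_le_succ hb.slack_le
  have hbody : ∀ s, I s → (Expr.reg 5).eval s ≠ 0 → Runs (.seq scanHead scan) s
      ((n + 1) ^ 2 * 310) fun s' => I s' ∧ μ s' < μ s := by
    rintro s ⟨A, T, hm, hb, h5, -⟩ hne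
    have h5' : s.reg 5 = 1 := by
      have : s.reg 5 ≠ 0 := hne
      omega
    have hhead : Runs scanHead s 10 fun s' => ScanInv P d A T (fun _ _ => False) s' ∧
        s'.reg 2 = 0 ∧ s'.reg 3 = 0 := by
      refine Runs.mono (Runs.of_loopFree (by simp [scanHead, Cmd.LoopFree]) ?_)
        (by simp [scanHead, Cmd.time, Expr.cost]) fun _ h => h
      refine ⟨⟨A, T, hm.of_eq rfl rfl rfl, hb, ?_, ?_, ?_⟩, ?_⟩ <;>
        simp [scanHead, Cmd.run, State.setReg, Expr.eval]
    refine (hhead.seq fun s₁ hs₁ => scan_runs hs₁.1 hs₁.2.1 hs₁.2.2).mono ?_ ?_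
    · have : 1 ≤ (n + 1) ^ 2 := Nat.one_le_pow _ _ (by omega)
      omega
    · rintro s' ⟨A', T', hm', hb', h1, hz, hnz⟩
      refine ⟨⟨A', T', hm', hb', h1, fun h => ?_⟩, ?_⟩
      · obtain ⟨rfl, rfl, hr⟩ := hz h
        exact fun u w hw => hr u w hw trivial
      · rw [hμ hm, hμ hm']
        by_cases h : s'.reg 5 = 0
        · obtain ⟨rfl, rfl, -⟩ := hz h
          omega
        · have := hnz h
          omega
  refine (hfirst.seq fun s₁ hs₁ => (Runs.loop I μ hbody s₁ hs₁.1).mono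
    (T' := (2 * (n + 1) ^ 2) * ((n + 1) ^ 2 * 320)) ?_ fun _ h => h).mono ?_ ?_
  · have := hs₁.2
    simp only [Expr.cost]
    refine Nat.mul_le_mul ?_ ?_ <;> nlinarith
  · have : 1 ≤ (n + 1) ^ 4 := Nat.one_le_pow _ _ (by omega)
    have e : (2 * (n + 1) ^ 2) * ((n + 1) ^ 2 * 320) = (n + 1) ^ 4 * 640 := by ring
    omega
  · rintro s' ⟨⟨A, T, hm, hb, -, hr⟩, h⟩
    exact ⟨A, T, hm, hb, hr h⟩

/-! ## Correctness of the output -/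

/-- Nothing is ever erased, so the description of unmatched agents relies on the output and the
marks having been zero until now. -/
theorem output_runs {P : Profile n} {d : ℕ} {A T : Fin n → ℕ} {s : State}
    (hs : HasBounds P d A T s) :
    Runs output s ((n + 1) * 100) fun s' => HasTables P d s' ∧ (∀ w : Fin n, s'.arr 8 w = T w) ∧
      (∀ u w, (u, w) ∈ pairsAt P A → s'.arr 4 u = w + 1) ∧
      (∀ u : Fin n, (∀ w, (u, w) ∉ pairsAt P A) → s'.arr 4 u = 0) ∧
      ∀ w : Fin n, s'.arr 9 w = 0 ↔ ∀ u, (u, w) ∉ pairsAt P A := by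
  let I : ℕ → State → Prop := fun i s => HasTables P d s ∧ s.reg 2 = i ∧
    (∀ u : Fin n, s.arr 7 u = A u) ∧ (∀ w : Fin n, s.arr 8 w = T w) ∧
    (∀ u w, (u, w) ∈ pairsAt P A → s.arr 4 u = if u < i then (w : ℕ) + 1 else 0) ∧
    (∀ u : Fin n, (∀ w, (u, w) ∉ pairsAt P A) → s.arr 4 u = 0) ∧
    ∀ w : Fin n, s.arr 9 w = 0 ↔ ∀ u : Fin n, u < i → (u, w) ∉ pairsAt P A
  have hfirst : Runs (.assign 2 (.const 0)) s 5 (I 0) := by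
    refine Runs.mono (Runs.of_loopFree trivial ?_) (by simp [Cmd.time, Expr.cost]) fun _ h => h
    refine ⟨hs.tables.of_eq rfl rfl rfl rfl rfl rfl rfl, ?_⟩
    simp [Cmd.run, State.setReg, Expr.eval, hs.arr_A, hs.arr_T, hs.out, hs.marks]
  refine (hfirst.seq fun s₁ hs₁ => (Runs.count (K := 50) (N := n) I ?_ ?_ s₁ hs₁).mono
    (T' := (n + 1) * 60) ?_ fun _ h => h).mono (by omega) ?_
  · rintro k s hk ⟨h, h2, -⟩
    simp only [Expr.eval, h.reg_n, h2]
    omega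
  · rintro i s hi ⟨ht, h2, hA, hT, ho, hn, hm⟩
    let u : Fin n := ⟨i, hi⟩
    refine Runs.mono (Runs.of_loopFree (by simp [outputPair, incr, Cmd.LoopFree]) ?_)
      (by simp [outputPair, incr, Cmd.time, Expr.cost]) fun _ h => h
    have hAu : s.arr 7 i = A u := hA u
    have hlen : s.arr 0 i = (P.listU u).length := ht.lenU u
    have hbase : s.arr 5 i = i * n := ht.base u
    by_cases hlt : A u < (P.listU u).length
    · have hent : s.arr 1 (i * n + A u) = (P.listU u)[A u] := ht.entU u _ hlt
      have hmem : ∀ w, (u, w) ∈ pairsAt P A ↔ w = (P.listU u)[A u] := fun w => by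
        have hr : rank (P.listU u) (P.listU u)[A u] = A u := rank_getElem (P.nodupU u) hlt
        rw [mem_pairsAt]
        constructor
        · rintro ⟨h, h'⟩
          exact rank_inj h (h'.trans hr.symm)
        · rintro rfl
          exact ⟨List.getElem_mem _, hr⟩
      generalize (P.listU u)[A u] = w₀ at hent hmem
      have hrun : outputPair.run s = (((s.setReg 6 w₀).setArr 4 i (w₀ + 1)).setArr 9 w₀ 1).setReg 2
          (i + 1) := by
        have : (P.listU u).length - A u ≠ 0 := by omega
        simp [outputPair, incr, Cmd.run, Expr.eval, State.setReg, State.setArr, h2, hAu, hlen, hbase,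
          hent, this]
      rw [hrun]
      refine ⟨ht.of_eq rfl rfl rfl rfl rfl rfl rfl, by simp [State.setReg], hA, hT, ?_, ?_, ?_⟩
      · intro v w hvw
        simp only [State.setReg, State.setArr]
        by_cases hv : v = u
        · subst hv
          obtain rfl := (hmem w).1 hvw
          simp [u]
        · have hv' : (v : ℕ) ≠ i := fun h => hv (Fin.ext h)
          simp [hv', ho v w hvw, le_iff_lt_or_eq]
      · intro v hv
        have hv' : (v : ℕ) ≠ i := fun h => by
          obtain rfl : v = u := Fin.ext h
          exact hv w₀ ((hmem w₀).2 rfl)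
        simp [State.setReg, State.setArr, hv', hn v hv]
      · intro w
        simp only [State.setReg, State.setArr]
        by_cases hw : w = w₀
        · subst hw
          simp only [Function.update_self, one_ne_zero, false_iff]
          exact fun h => h u (Nat.lt_succ_self i) ((hmem w).2 rfl)
        · have hw' : (w : ℕ) ≠ w₀ := fun h => hw (Fin.ext h)
          simp only [Function.update_self, Function.update_of_ne hw',
            Function.update_of_ne (by decide : (9 : ℕ) ≠ 4), hm]
          refine ⟨fun h v hv => ?_, fun h v hv => h v (hv.trans (Nat.lt_succ_self i))⟩
          rcases (Nat.lt_succ_iff.1 hv).lt_or_eq with hv | hv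
          · exact h v hv
          · obtain rfl : v = u := Fin.ext hv
            exact fun h' => hw ((hmem w).1 h')
    · have hrun : outputPair.run s = s.setReg 2 (i + 1) := by
        have : (P.listU u).length - A u = 0 := by omega
        simp [outputPair, incr, Cmd.run, Expr.eval, h2, hAu, hlen, this]
      have hnm : ∀ w, (u, w) ∉ pairsAt P A := fun w hw => by
        obtain ⟨h1, h2⟩ := mem_pairsAt.1 hw
        have := rank_lt_length.2 h1
        omega
      rw [hrun]
      refine ⟨ht.of_eq rfl rfl rfl rfl rfl rfl rfl, by simp [State.setReg], hA, hT, ?_, hn, ?_⟩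
      · intro v w hvw
        have hv' : (v : ℕ) ≠ i := fun h => by
          obtain rfl : v = u := Fin.ext h
          exact hnm w hvw
        have := ho v w hvw
        simp [State.setReg, this, le_iff_lt_or_eq, hv']
      · intro w
        refine (hm w).trans ⟨fun h v hv => ?_, fun h v hv => h v (hv.trans (Nat.lt_succ_self i))⟩
        rcases (Nat.lt_succ_iff.1 hv).lt_or_eq with hv | hv
        · exact h v hv
        · obtain rfl : v = u := Fin.ext hv
          exact hnm w
  · simp only [Expr.cost]
    gcongr
    norm_num
  · rintro s' ⟨ht, -, -, hT, ho, hn, hm⟩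
    exact ⟨ht, hT, fun u w h => by simpa using ho u w h, hn, fun w => by simpa using hm w⟩

theorem check_runs {P : Profile n} {d : ℕ} {T : Fin n → ℕ} {s : State}
    (hs : HasTables P d s) (hT : ∀ w : Fin n, s.arr 8 w = T w) :
    Runs check s ((n + 1) * 100) fun s' => s'.arr = s.arr ∧
      (s'.reg 0 = 1 ∧ (∀ w : Fin n, T w ≤ (P.listW w).length → s.arr 9 w ≠ 0) ∨
        s'.reg 0 = 0 ∧ ∃ w : Fin n, T w ≤ (P.listW w).length ∧ s.arr 9 w = 0) := by
  let I : ℕ → State → Prop := fun i s' => s'.arr = s.arr ∧ s'.reg 0 = n ∧ s'.reg 2 = i ∧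
    (s'.reg 10 = 1 ∧ (∀ w : Fin n, w < i → T w ≤ (P.listW w).length → s.arr 9 w ≠ 0) ∨
      s'.reg 10 = 0 ∧ ∃ w : Fin n, T w ≤ (P.listW w).length ∧ s.arr 9 w = 0)
  have hfirst : Runs (.seq (.assign 2 (.const 0)) (.assign 10 (.const 1))) s 10 (I 0) := by
    refine Runs.mono (Runs.of_loopFree (by simp [Cmd.LoopFree]) ?_)
      (by simp [Cmd.time, Expr.cost]) fun _ h => h
    simp [I, Cmd.run, State.setReg, Expr.eval, hs.reg_n]
  have hlast : ∀ s₁, I n s₁ → Runs (.assign 0 (.reg 10)) s₁ 5 fun s' => s'.arr = s.arr ∧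
      (s'.reg 0 = 1 ∧ (∀ w : Fin n, T w ≤ (P.listW w).length → s.arr 9 w ≠ 0) ∨
        s'.reg 0 = 0 ∧ ∃ w : Fin n, T w ≤ (P.listW w).length ∧ s.arr 9 w = 0) := by
    rintro s₁ ⟨ha, -, -, h⟩
    refine Runs.mono (Runs.of_loopFree trivial ?_) (by simp [Cmd.time, Expr.cost]) fun _ h => h
    refine ⟨ha, ?_⟩
    simpa [Cmd.run, State.setReg, Expr.eval] using h
  refine (hfirst.seq fun s₁ hs₁ => ((Runs.count (K := 50) (N := n) I ?_ ?_ s₁ hs₁).mono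
    (T' := (n + 1) * 60) ?_ fun _ h => h).seq hlast).mono (by omega) fun _ h => h
  · rintro k s hk ⟨-, h0, h2, -⟩
    simp only [Expr.eval, h0, h2]
    omega
  · rintro i s' hi ⟨ha, h0, h2, h⟩
    let w : Fin n := ⟨i, hi⟩
    refine Runs.mono (Runs.of_loopFree (by simp [checkAgent, incr, Cmd.LoopFree]) ?_)
      (by simp [checkAgent, incr, Cmd.time, Expr.cost]) fun _ h => h
    have hTw : s.arr 8 i = T w := hT w
    have hlen : s.arr 2 i = (P.listW w).length := hs.lenW w
    by_cases hc : T w ≤ (P.listW w).length ∧ s.arr 9 i = 0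
    · have hrun : checkAgent.run s' = (s'.setReg 10 0).setReg 2 (i + 1) := by
        have : (P.listW w).length + 1 - T w ≠ 0 := by omega
        simp [checkAgent, incr, Cmd.run, Expr.eval, State.setReg, ha, h2, hTw, hlen, this, hc.2]
      rw [hrun]
      exact ⟨ha, by simp [State.setReg, h0], by simp [State.setReg],
        Or.inr ⟨by simp [State.setReg], w, hc⟩⟩
    · have hrun : checkAgent.run s' = s'.setReg 2 (i + 1) := by
        by_cases hle : T w ≤ (P.listW w).length
        · have : (P.listW w).length + 1 - T w ≠ 0 := by omega
          have h9 : s.arr 9 i ≠ 0 := fun h => hc ⟨hle, h⟩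
          simp [checkAgent, incr, Cmd.run, Expr.eval, ha, h2, hTw, hlen, this, h9]
        · have : (P.listW w).length + 1 - T w = 0 := by omega
          simp [checkAgent, incr, Cmd.run, Expr.eval, ha, h2, hTw, hlen, this]
      rw [hrun]
      refine ⟨ha, by simp [State.setReg, h0], by simp [State.setReg], ?_⟩
      refine h.imp (And.imp (fun h => by simpa [State.setReg] using h) fun h v hv hle => ?_)
        (And.imp_left fun h => by simpa [State.setReg] using h)
      rcases (Nat.lt_succ_iff.1 hv).lt_or_eq with hv | hv
      · exact h v hv hle
      · obtain rfl : v = w := Fin.ext hv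
        exact fun h' => hc ⟨hle, h'⟩
  · simp only [Expr.cost]
    gcongr
    norm_num

end StableMarriage

theorem mainTheorem1 :
    ∃ (prog : RAM.Cmd) (C : ℕ),
      ∀ (n : ℕ) (P : StableMarriage.Profile n) (d : ℕ),
        ∃ (t : ℕ) (s : RAM.State),
          RAM.Exec prog (StableMarriage.inputState P d) t s ∧
          t ≤ C * (n ^ 4 + 1) ∧
          ((∃ M : Finset (Fin n × Fin n),
              StableMarriage.IsRobust P d M ∧ StableMarriage.OutputsMatching s M) ∨
            ((¬ ∃ M : Finset (Fin n × Fin n), StableMarriage.IsRobust P d M) ∧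
              StableMarriage.OutputsNone s)) := by
  refine ⟨StableMarriage.robustProgram, 100000, fun n P d => ?_⟩
  suffices h : RAM.Runs StableMarriage.robustProgram (StableMarriage.inputState P d)
      ((n + 1) ^ 4 * 3000) fun s => ((∃ M : Finset (Fin n × Fin n),
              StableMarriage.IsRobust P d M ∧ StableMarriage.OutputsMatching s M) ∨
            ((¬ ∃ M : Finset (Fin n × Fin n), StableMarriage.IsRobust P d M) ∧
              StableMarriage.OutputsNone s)) by
    obtain ⟨t, s, he, ht, hq⟩ := h
    refine ⟨t, s, he, ht.trans ?_, hq⟩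
    -- The summand `1` in the bound covers `n = 0`; for positive `n`, `n + 1 ≤ 2 * n`.
    have : (n + 1) ^ 4 ≤ 16 * (n ^ 4 + 1) := by
      rcases Nat.eq_zero_or_pos n with rfl | hn
      · norm_num
      · calc (n + 1) ^ 4 ≤ (2 * n) ^ 4 := Nat.pow_le_pow_left (by omega) 4
          _ ≤ 16 * (n ^ 4 + 1) := by rw [mul_pow]; omega
    omega
  refine ((StableMarriage.setup_runs P d).seq fun s₁ h₁ =>
    (StableMarriage.relaxAll_runs h₁ (StableMarriage.isBound_initial P d)).seq fun s₂ h₂ => ?_).mono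
    (T := (n + 1) ^ 2 * 100 + ((n + 1) ^ 4 * 2000 + ((n + 1) * 100 + (n + 1) * 100))) ?_
    fun _ h => h
  · obtain ⟨A, T, hm, hb, hr⟩ := h₂
    refine (StableMarriage.output_runs hm).seq fun s₃ h₃ => ?_
    obtain ⟨g0, g1, g2, g3, g4⟩ := h₃
    refine (StableMarriage.check_runs g0 g1).mono le_rfl fun s₄ h₄ => ?_
    obtain ⟨e, ⟨h0, hw⟩ | ⟨h0, w, hw, hw'⟩⟩ := h₄
    · refine Or.inl ⟨_, hb.isRobust_pairsAt hr fun w hle => ?_, h0, ?_, ?_⟩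
      · have := mt (g4 w).2 (hw w hle)
        push Not at this
        exact this
      · rwa [e]
      · rwa [e]
    -- An agent that must be matched carries no mark, which the counting argument rules out if a
    -- robust matching exists.
    · refine Or.inr ⟨?_, h0⟩
      rintro ⟨M, hM⟩
      obtain ⟨u, hu⟩ := hb.exists_mem_pairsAt_of_isRobust hr hM hw
      exact (g4 w).1 hw' u hu
  · have h1 : (n + 1) ^ 1 ≤ (n + 1) ^ 4 := Nat.pow_le_pow_right (by omega) (by omega)
    have h2 : (n + 1) ^ 2 ≤ (n + 1) ^ 4 := Nat.pow_le_pow_right (by omega) (by omega)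
    rw [pow_one] at h1
    omega
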